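/- **Conventions.** An orthoalgebra is a set $A$ with a partial binary operation $\oplus$, a unary operation $'$ and constants $0,1$ such that $\oplus$ is commutative and associative (one side is defined iff the other is, and then they are equal), $a'$ is the unique element with $a\oplus a'$ defined and equal to $1$, and $a\oplus a$ is defined iff $a=0$. An isomorphism of orthoalgebras is a bijection $f$ such that $f$ and $f^{-1}$ preserve $'$ and all defined sums. Let $\mathrm{BSub}(A)$ be the set of Boolean subalgebras of $A$ (subsets containing $0,1$, closed under $'$ and defined sums, on which the structure is that of a Boolean algebra with $\oplus$ the join of disjoint elements), ordered by inclusion, and let $\mathrm{BSub}(A)^*$ be the poset of its elements of height at most $3$. $A$ is proper if no maximal Boolean subalgebra has $4$ or fewer elements. A hypergraph is a triple $(P,L,T)$ of a set $P$ of points, a set $L$ of $3$-element subsets of $P$ (lines) and a set $T$ of $7$-element subsets of $P$ (planes), such that each plane can be written $\{c_0,c_1,c_2,c_3,e_{01|23},e_{02|13},e_{03|12}\}$ so that the lines contained in it are exactly the six sets $\{c_i,c_j,e_\pi\}$ with $i\ne j$ and $\pi$ the partition having $\{i,j\}$ as a block. The hypergraph $\mathcal G(A)$ has as points the atoms of $\mathrm{BSub}(A)$,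 as lines the sets of atoms under an element of height $2$, and as planes the sets of atoms under an element of height $3$. For a hypergraph $\mathcal H$ let $X(\mathcal H)$ be the poset consisting of a least element $\bot$, the points, the lines and the planes, where points lie below the lines and planes that contain them and a line lies below the planes that contain it. An orthodomain is a poset $X$ with least element $\bot$ in which directed subsets have joins, which is atomistic with compact atoms, in which every principal ideal is isomorphic to the subalgebra lattice of a Boolean algebra, and in which $x\vee y=w$ whenever $x\neq y$ are atoms covered by $w$. An element is basic if it is $\bot$ or an atom. An element $u$ of a lattice is dual modular if $(u\vee p)\wedge q=u\vee(p\wedge q)$ whenever $u\le q$ and $(p\vee u)\wedge q=p\vee(u\wedge q)$ whenever $p\le q$. In a principal ideal $\downarrow w$ with greatest element $\top=w$, a principal pair for a basic element $x$ is a pair $(y,z)$ of dual modular elements with $y\wedge z=x$ such that $y=\top$ and $z$ is basic, or $z=\top$ and $y$ is basic, or $y\vee z=\top$ and $x$ is not dual modular. A direction for a basic element $x$ is a map $d\colon\{y\in X: y\ge x\}\to X^2$ such that for all $y,z\ge x$: 1. $d(y)$ is a principal pair for $x$ in $\downarrow y$; 2. if $y\le z$ and $d(z)=(v,w)$, then $d(y)=(y\wedge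 v,y\wedge w)$; 3. if $y,z$ cover $x$, $d(y)=(x,y)$ and $d(z)=(z,x)$, then $y\vee z$ exists and covers $y$ and $z$. $X$ has enough directions if no maximal element is basic and each basic element has a direction. Let $\mathrm{Dir}(X)$ be the set of directions, with $d'$ obtained from $d$ by swapping the two components of every value, $0(w)=(\bot,w)$ and $1(w)=(w,\bot)$ for $w\in X$, and with $\oplus$ given by $d\oplus 0=d=0\oplus d$, $d\oplus d'=1$ and the following case. If $d,e$ are directions for distinct atoms $x,y$ whose join $w$ exists and covers both, and $d(w)=(x,w)$, $e(w)=(y,w)$, then $d\oplus e$ is the direction for the third atom $z$ under $w$ with $(d\oplus e)(w)=(w,z)$. No other sums are defined. **Theorem.** Let $A$ be an orthoalgebra. Then $\mathcal G(A)$ is a hypergraph, and sending each $B\in\mathrm{BSub}(A)^*$ to the set of atoms of $\mathrm{BSub}(A)$ below it yields an isomorphism of posets $\mathrm{BSub}(A)^*\cong X(\mathcal G(A))$ (where $\bot$ and a point $p$ correspond to $\emptyset$ and $\{p\}$). Hence $\mathrm{BSub}(A)^*\cong X(\mathcal H)$ for each hypergraph $\mathcal H$ isomorphic to $\mathcal G(A)$.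 If moreover $A$ is proper, then $\mathrm{BSub}(A)^*$ is an orthodomain with enough directions, $\mathrm{Dir}(\mathrm{BSub}(A)^*)$ is an orthoalgebra, and it is isomorphic to $A$; likewise, for each hypergraph $\mathcal H\cong\mathcal G(A)$, the poset $X(\mathcal H)$ is an orthodomain with enough directions, and $\mathrm{Dir}(X(\mathcal H))$ is an orthoalgebra isomorphic to $A$. -/

import Mathlib

universe u v

namespace Ortho

/-! ### Orthoalgebras -/

/-- The signature of an orthoalgebra: constants `0`, `1`, a unary operation `ᶜ` and a partial
binary operation `⊕`; the value `none` means that the sum is not defined. -/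
class OrthoStruct (A : Type u) extends Zero A, One A, Compl A where
  oplus : A → A → Option A

open OrthoStruct

/-- The laws of an orthoalgebra. An equation between two values of `Option A` says that one side is
defined if and only if the other one is, and that they are then equal. -/
class IsOrthoalgebra (A : Type u) [OrthoStruct A] : Prop where
  comm : ∀ a b : A, oplus a b = oplus b a
  assoc : ∀ a b c : A, ((oplus a b).bind fun s => oplus s c) = ((oplus b c).bind fun s => oplus a s)
  oplus_compl : ∀ a : A, oplus a aᶜ = some 1
  compl_unique : ∀ a b : A, oplus a b = some 1 → b = aᶜ
  oplus_self : ∀ a : A, (∃ c, oplus a a = some c) ↔ a = 0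

/-- Orthoalgebra morphisms. -/
def IsMorphism {A : Type u} {C : Type v} [OrthoStruct A] [OrthoStruct C] (f : A → C) : Prop :=
  (∀ a, f aᶜ = (f a)ᶜ) ∧ ∀ a b c, oplus a b = some c → oplus (f a) (f b) = some (f c)

/-- Orthoalgebra isomorphisms: morphisms whose set-theoretic inverse is a morphism. -/
def IsIsomorphism {A : Type u} {C : Type v} [OrthoStruct A] [OrthoStruct C] (f : A → C) : Prop :=
  IsMorphism f ∧
    ∃ g : C → A, IsMorphism g ∧ Function.LeftInverse g f ∧ Function.RightInverse g f

/-- The structure is Boolean: it arises from a Boolean algebra by restricting the join to pairs of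
orthogonal elements. -/
def IsBoolean (A : Type u) [OrthoStruct A] : Prop :=
  ∃ (B : Type u) (_ : BooleanAlgebra B) (f : A ≃ B),
    f 0 = ⊥ ∧ f 1 = ⊤ ∧ (∀ a, f aᶜ = (f a)ᶜ) ∧
      ∀ a b c, oplus a b = some c ↔ Disjoint (f a) (f b) ∧ f a ⊔ f b = f c

/-- Subalgebras of an orthoalgebra. -/
structure Subalg (A : Type u) [OrthoStruct A] where
  carrier : Set A
  zero_mem : 0 ∈ carrier
  one_mem : 1 ∈ carrier
  compl_mem : ∀ a ∈ carrier, aᶜ ∈ carrier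
  oplus_mem : ∀ a ∈ carrier, ∀ b ∈ carrier, ∀ c, oplus a b = some c → c ∈ carrier

/-- The operations of a subalgebra are the restrictions of those of the ambient orthoalgebra. -/
instance {A : Type u} [OrthoStruct A] (S : Subalg A) : OrthoStruct S.carrier where
  zero := ⟨0, S.zero_mem⟩
  one := ⟨1, S.one_mem⟩
  compl a := ⟨(a : A)ᶜ, S.compl_mem a a.2⟩
  oplus a b := (oplus (a : A) (b : A)).pmap (fun c hc => ⟨c, hc⟩)
    (fun c hc => S.oplus_mem a a.2 b b.2 c hc)

/-- The Boolean subalgebras of an orthoalgebra. -/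
structure BSub (A : Type u) [OrthoStruct A] where
  toSubalg : Subalg A
  isBoolean : IsBoolean toSubalg.carrier

/-- The set of elements of a Boolean subalgebra. -/
def BSub.carrier {A : Type u} [OrthoStruct A] (B : BSub A) : Set A := B.toSubalg.carrier

theorem BSub.carrier_injective {A : Type u} [OrthoStruct A] :
    Function.Injective fun B : BSub A => B.carrier := by
  rintro ⟨⟨s, _, _, _, _⟩, _⟩ ⟨⟨t, _, _, _, _⟩, _⟩ h
  change s = t at h
  cases h
  rfl

/-- Boolean subalgebras are ordered by inclusion. -/
instance {A : Type u} [OrthoStruct A] : PartialOrder (BSub A) :=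
  PartialOrder.lift (fun B => B.carrier) BSub.carrier_injective

theorem Subalg.oplus_eq_some_iff {A : Type u} [OrthoStruct A] (S : Subalg A) (a b c : S.carrier) :
    oplus a b = some c ↔ oplus (a : A) (b : A) = some (c : A) := by
  change (oplus (a : A) (b : A)).pmap _ _ = some c ↔ _
  rw [Option.pmap_eq_some_iff]
  constructor
  · rintro ⟨x, hx, h, rfl⟩
    exact h
  · intro h
    exact ⟨c, c.2, h, rfl⟩

section Bottom

variable {A : Type u} [OrthoStruct A] [IsOrthoalgebra A]

theorem compl_one : (1 : A)ᶜ = 0 := by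
  have h1 := IsOrthoalgebra.oplus_compl (1 : A)
  have h2 := IsOrthoalgebra.assoc (1 : A) 1ᶜ 1ᶜ
  rw [h1, Option.bind_some, h1] at h2
  rw [← IsOrthoalgebra.oplus_self]
  cases h : oplus (1 : A)ᶜ 1ᶜ with
  | none => rw [h] at h2; cases h2
  | some c => exact ⟨c, rfl⟩

theorem one_oplus_zero : oplus (1 : A) 0 = some 1 := by
  have := IsOrthoalgebra.oplus_compl (1 : A)
  rwa [compl_one] at this

theorem compl_zero : (0 : A)ᶜ = 1 :=
  (IsOrthoalgebra.compl_unique _ _ ((IsOrthoalgebra.comm _ _).trans one_oplus_zero)).symm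

theorem compl_compl' (a : A) : aᶜᶜ = a :=
  (IsOrthoalgebra.compl_unique _ _
    ((IsOrthoalgebra.comm _ _).trans (IsOrthoalgebra.oplus_compl a))).symm

theorem oplus_zero (a : A) : oplus a 0 = some a := by
  have h2 := IsOrthoalgebra.assoc aᶜ a 0
  rw [IsOrthoalgebra.comm aᶜ a, IsOrthoalgebra.oplus_compl a, Option.bind_some,
    one_oplus_zero] at h2
  cases h : oplus a 0 with
  | none => rw [h] at h2; cases h2
  | some c =>
    rw [h, Option.bind_some] at h2
    rw [IsOrthoalgebra.compl_unique _ _ h2.symm, compl_compl']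

variable (A) in
/-- The subalgebra `{0, 1}`. -/
def botSubalg : Subalg A where
  carrier := {0, 1}
  zero_mem := by simp
  one_mem := by simp
  compl_mem := by
    rintro a (rfl | rfl)
    · simp [compl_zero]
    · simp [compl_one]
  oplus_mem := by
    rintro a (rfl | rfl) b (rfl | rfl) c h
    · rw [oplus_zero] at h; cases h; simp
    · rw [IsOrthoalgebra.comm, oplus_zero] at h; cases h; simp
    · rw [oplus_zero] at h; cases h; simp
    · have := (IsOrthoalgebra.oplus_self (1 : A)).1 ⟨c, h⟩
      rw [this, oplus_zero] at h; cases h; simp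

theorem isBoolean_botSubalg : IsBoolean (botSubalg A).carrier := by
  classical
  have key : ∀ a : (botSubalg A).carrier, a = 0 ∨ a = 1 := fun a =>
    a.2.imp (fun h => Subtype.ext h) (fun h => Subtype.ext h)
  have c0 : (0 : (botSubalg A).carrier)ᶜ = 1 := Subtype.ext (compl_zero (A := A))
  have c1 : (1 : (botSubalg A).carrier)ᶜ = 0 := Subtype.ext (compl_one (A := A))
  have s00 : oplus (0 : (botSubalg A).carrier) 0 = some 0 :=
    (Subalg.oplus_eq_some_iff _ _ _ _).2 (oplus_zero (0 : A))
  have s10 : oplus (1 : (botSubalg A).carrier) 0 = some 1 :=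
    (Subalg.oplus_eq_some_iff _ _ _ _).2 (oplus_zero (1 : A))
  have s01 : oplus (0 : (botSubalg A).carrier) 1 = some 1 :=
    (Subalg.oplus_eq_some_iff _ _ _ _).2 ((IsOrthoalgebra.comm _ _).trans (oplus_zero (1 : A)))
  have s11 : ∀ c, oplus (1 : (botSubalg A).carrier) 1 = some c →
      (1 : (botSubalg A).carrier) = 0 := fun c h => Subtype.ext
    ((IsOrthoalgebra.oplus_self (1 : A)).1 ⟨c, (Subalg.oplus_eq_some_iff _ _ _ _).1 h⟩)
  by_cases h01 : (1 : (botSubalg A).carrier) = 0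
  · have sub : ∀ a b : (botSubalg A).carrier, a = b := by
      intro a b
      rcases key a with rfl | rfl <;> rcases key b with rfl | rfl <;> simp [h01]
    refine ⟨PUnit, inferInstance, ⟨fun _ => PUnit.unit, fun _ => 0, fun a => sub _ _,
      fun _ => rfl⟩, rfl, rfl, fun _ => rfl, fun a b c => ?_⟩
    rw [sub a 0, sub b 0, sub c 0, s00]
    simp
  · refine ⟨Set PUnit.{u + 1}, inferInstance, ⟨fun a => {_x | a = 1},
      fun s => if s = ∅ then 0 else 1, fun a => ?_, fun s => ?_⟩, ?_, ?_, fun a => ?_,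
      fun a b c => ?_⟩
    · rcases key a with rfl | rfl
      · simp [Ne.symm h01]
      · simp
    · rcases s.eq_empty_or_nonempty with rfl | ⟨x, hx⟩
      · simp [Ne.symm h01]
      · have : s = Set.univ := Set.eq_univ_of_forall fun y => by cases x; cases y; exact hx
        subst this
        simp
    · simp [Ne.symm h01]
    · simp
    · rcases key a with rfl | rfl
      · simp [c0, Ne.symm h01]
      · simp [c1, Ne.symm h01]
    · rcases key a with rfl | rfl <;> rcases key b with rfl | rfl <;>
        rcases key c with rfl | rfl <;>
        simp [s00, s10, s01, h01, Ne.symm h01]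
      all_goals first
        | exact fun h => h01 (s11 _ h)
        | exact fun h => by simpa using h.symm.le (Set.mem_univ PUnit.unit)

/-- The least Boolean subalgebra is `{0, 1}`. -/
instance : OrderBot (BSub A) where
  bot := ⟨botSubalg A, isBoolean_botSubalg⟩
  bot_le B := by
    rintro a (rfl | rfl)
    · exact B.toSubalg.zero_mem
    · exact B.toSubalg.one_mem

end Bottom

/-- `A` is proper: no block (maximal Boolean subalgebra) has four or fewer elements. -/
def IsProper (A : Type u) [OrthoStruct A] : Prop :=
  ∀ B : BSub A, IsMax B → 4 < B.carrier.encard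

/-- The poset `BSub(A)*` of Boolean subalgebras of height at most `3`. -/
abbrev BSubStar (A : Type u) [OrthoStruct A] : Type u :=
  {B : BSub A // Order.height B ≤ 3}

instance {A : Type u} [OrthoStruct A] [IsOrthoalgebra A] : OrderBot (BSubStar A) where
  bot := ⟨⊥, by simp⟩
  bot_le B := bot_le (a := B.1)

/-! ### Directions of posets -/

section Poset

variable {X : Type u} [PartialOrder X]

/-- Basic elements: the least element and the atoms. -/
def IsBasic [OrderBot X] (x : X) : Prop := x = ⊥ ∨ IsAtom x

/-- Dual modular elements. In a lattice this says that `(x ∨ y) ∧ z = x ∨ (y ∧ z)` whenever `x ≤ z`,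
and `(w ∨ x) ∧ y = w ∨ (x ∧ y)` whenever `w ≤ y`; the joins and meets are expressed through the
order, so that the definition can be applied to principal ideals of a poset. -/
def IsDualModular (x : X) : Prop :=
  (∀ y z j m k : X, x ≤ z → IsLUB {x, y} j → IsGLB {y, z} m → IsGLB {j, z} k → IsLUB {x, m} k) ∧
  (∀ w y j m k : X, w ≤ y → IsLUB {w, x} j → IsGLB {x, y} m → IsGLB {j, y} k → IsLUB {w, m} k)

/-- Principal pairs (of a Boolean domain). -/
def IsPrincipalPair [BoundedOrder X] (y z : X) : Prop :=
  IsDualModular y ∧ IsDualModular z ∧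
    ((y = ⊤ ∧ IsBasic z) ∨ (z = ⊤ ∧ IsBasic y) ∨
      (IsLUB {y, z} ⊤ ∧ ∃ x, IsGLB {y, z} x ∧ IsBasic x ∧ ¬ IsDualModular x))

/-- Principal pairs for the element `x`: those with `y ∧ z = x`. -/
def IsPrincipalPairFor [BoundedOrder X] (x y z : X) : Prop :=
  IsPrincipalPair y z ∧ IsGLB {y, z} x

theorem IsPrincipalPairFor.symm [BoundedOrder X] {x y z : X} (h : IsPrincipalPairFor x y z) :
    IsPrincipalPairFor x z y := by
  obtain ⟨⟨hy, hz, h⟩, hx⟩ := h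
  refine ⟨⟨hz, hy, ?_⟩, by rwa [Set.pair_comm]⟩
  rcases h with h | h | h
  · exact Or.inr (Or.inl h)
  · exact Or.inl h
  · rw [Set.pair_comm] at h
    exact Or.inr (Or.inr h)

theorem isLUB_pair_of_le {a b : X} (h : a ≤ b) : IsLUB {a, b} b := by
  refine ⟨?_, fun c hc => hc (by simp)⟩
  rintro c (rfl | rfl)
  · exact h
  · exact le_rfl

theorem isGLB_pair_of_le {a b : X} (h : a ≤ b) : IsGLB {a, b} a := by
  refine ⟨?_, fun c hc => hc (by simp)⟩
  rintro c (rfl | rfl)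
  · exact le_rfl
  · exact h

theorem isDualModular_bot [OrderBot X] : IsDualModular (⊥ : X) := by
  constructor
  · intro y z j m k _ hj hm hk
    obtain rfl := hj.unique (isLUB_pair_of_le bot_le)
    obtain rfl := hk.unique hm
    exact isLUB_pair_of_le bot_le
  · intro w y j m k h hj hm hk
    rw [Set.pair_comm] at hj
    obtain rfl := hj.unique (isLUB_pair_of_le bot_le)
    obtain rfl := hm.unique (isGLB_pair_of_le bot_le)
    obtain rfl := hk.unique (isGLB_pair_of_le h)
    rw [Set.pair_comm]
    exact isLUB_pair_of_le bot_le

theorem isDualModular_top [OrderTop X] : IsDualModular (⊤ : X) := by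
  constructor
  · intro y z j m k hz hj hm hk
    obtain rfl := top_le_iff.1 hz
    rw [Set.pair_comm] at hj ⊢
    obtain rfl := hj.unique (isLUB_pair_of_le le_top)
    obtain rfl := hk.unique (isGLB_pair_of_le le_top)
    exact isLUB_pair_of_le le_top
  · intro w y j m k h hj hm hk
    obtain rfl := hj.unique (isLUB_pair_of_le le_top)
    rw [Set.pair_comm] at hm hk
    obtain rfl := hm.unique (isGLB_pair_of_le le_top)
    obtain rfl := hk.unique (isGLB_pair_of_le le_top)
    exact isLUB_pair_of_le h

theorem isPrincipalPairFor_bot_top [BoundedOrder X] : IsPrincipalPairFor (⊥ : X) ⊥ ⊤ :=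
  ⟨⟨isDualModular_bot, isDualModular_top, Or.inr (Or.inl ⟨rfl, Or.inl rfl⟩)⟩,
    isGLB_pair_of_le bot_le⟩

variable [OrderBot X]

variable (X) in
/-- A direction of `X`: a map `d : ↑x → X × X` for a basic element `x` such that `d y` is a
principal pair for `x` in the principal ideal `↓y`, such that `d` is compatible with meets, and such
that covers `y`, `z` of `x` at which `d` takes the values `(x, y)` and `(z, x)` have a join that
covers both. -/
@[ext] structure Direction where
  base : X
  basic : IsBasic base
  toFun : Set.Ici base → X × X
  principal : ∀ y : Set.Ici base, ∃ (h₁ : (toFun y).1 ≤ y) (h₂ : (toFun y).2 ≤ y),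
    IsPrincipalPairFor (X := Set.Iic (y : X)) ⟨base, y.2⟩ ⟨(toFun y).1, h₁⟩ ⟨(toFun y).2, h₂⟩
  restrict : ∀ y z : Set.Ici base, y ≤ z →
    IsGLB {(y : X), (toFun z).1} (toFun y).1 ∧ IsGLB {(y : X), (toFun z).2} (toFun y).2
  join : ∀ y z : Set.Ici base, base ⋖ (y : X) → base ⋖ (z : X) →
    toFun y = (base, (y : X)) → toFun z = ((z : X), base) →
      ∃ u, IsLUB {(y : X), (z : X)} u ∧ (y : X) ⋖ u ∧ (z : X) ⋖ u

namespace Direction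

/-- The complementary direction `d'`, with `d' w = (z, y)` if `d w = (y, z)`. -/
def compl (d : Direction X) : Direction X where
  base := d.base
  basic := d.basic
  toFun y := (d.toFun y).swap
  principal y := by
    obtain ⟨h₁, h₂, h⟩ := d.principal y
    exact ⟨h₂, h₁, h.symm⟩
  restrict y z h := (d.restrict y z h).symm
  join y z hy hz h₁ h₂ := by
    obtain ⟨u, hu, h, h'⟩ := d.join z y hz hy (by rw [← Prod.swap_swap (d.toFun z), h₂]; rfl)
      (by rw [← Prod.swap_swap (d.toFun y), h₁]; rfl)
    exact ⟨u, by rwa [Set.pair_comm], h', h⟩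

/-- The direction `0` for `⊥`, with `0 w = (⊥, w)`. -/
def zero : Direction X where
  base := ⊥
  basic := Or.inl rfl
  toFun y := (⊥, (y : X))
  principal y := ⟨bot_le, le_rfl, isPrincipalPairFor_bot_top (X := Set.Iic (y : X))⟩
  restrict y z h := by
    refine ⟨?_, isGLB_pair_of_le h⟩
    rw [Set.pair_comm]
    exact isGLB_pair_of_le bot_le
  join y z _ hz _ h := by
    exact absurd (congrArg Prod.fst h).symm hz.lt.ne'

/-- Near atoms `x`, `y` with join `w`. -/
def NearWithJoin (x y w : X) : Prop :=
  IsAtom x ∧ IsAtom y ∧ x ≠ y ∧ IsLUB {x, y} w ∧ x ⋖ w ∧ y ⋖ w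

/-- `f` is the sum `d ⊕ e`. In the last case `d` and `e` are directions for near atoms `x` and `y`
with join `w`, `d w = (x, w)`, `e w = (y, w)`, and `f` is the direction for the third atom `z`
beneath `w` with `f w = (w, z)`. -/
def IsSum (d e f : Direction X) : Prop :=
  (d = zero ∧ f = e) ∨ (e = zero ∧ f = d) ∨ (e = d.compl ∧ f = zero.compl) ∨
    ∃ (w : X) (hd : d.base ≤ w) (he : e.base ≤ w) (hf : f.base ≤ w),
      NearWithJoin d.base e.base w ∧ d.toFun ⟨w, hd⟩ = (d.base, w) ∧
        e.toFun ⟨w, he⟩ = (e.base, w) ∧ IsAtom f.base ∧ f.base ≠ d.base ∧ f.base ≠ e.base ∧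
          f.toFun ⟨w, hf⟩ = (w, f.base)

open Classical in
/-- The operations on directions. -/
noncomputable instance : OrthoStruct (Direction X) where
  zero := zero
  one := zero.compl
  compl := compl
  oplus d e := if h : ∃ f, IsSum d e f then some h.choose else none

end Direction

end Poset

/-! ### Orthodomains -/

/-- Boolean domains: the posets isomorphic to the lattice of subalgebras of a Boolean algebra. -/
def IsBooleanDomain (X : Type u) [PartialOrder X] : Prop :=
  ∃ (B : Type u) (_ : BooleanAlgebra B), Nonempty (X ≃o BooleanSubalgebra B)

/-- Orthodomains. -/
structure IsOrthodomain (X : Type u) [PartialOrder X] [OrderBot X] : Prop where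
  directed_join : ∀ S : Set X, S.Nonempty → DirectedOn (· ≤ ·) S → ∃ u, IsLUB S u
  atomistic : IsAtomistic X
  compact_atom : ∀ x : X, IsAtom x → IsCompactElement x
  ideal : ∀ x : X, IsBooleanDomain (Set.Iic x)
  join_atoms : ∀ x y w : X, IsAtom x → IsAtom y → x ≠ y → x ⋖ w → y ⋖ w → IsLUB {x, y} w

/-- An orthodomain with enough directions: no maximal element is basic, and each basic element has
a direction. -/
structure HasEnoughDirections (X : Type u) [PartialOrder X] [OrderBot X] : Prop where
  orthodomain : IsOrthodomain X
  proper : ∀ x : X, IsMax x → ¬ IsBasic x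
  exists_direction : ∀ x : X, IsBasic x → ∃ d : Direction X, d.base = x

/-! ### Hypergraphs -/

/-- A set of points with distinguished sets of points, called lines and planes. -/
structure PointLinePlane where
  Point : Type u
  lines : Set (Set Point)
  planes : Set (Set Point)

/-- The six lines of a plane. The corner points are `0`, `1`, `2`, `3`; the edge points are `4`
(on the lines joining `0` to `1` and `2` to `3`), `5` (on the lines joining `0` to `2` and `1` to
`3`) and `6` (on the lines joining `0` to `3` and `1` to `2`). -/
def planeLines : Set (Set (Fin 7)) :=
  {{0, 1, 4}, {2, 3, 4}, {0, 2, 5}, {1, 3, 5}, {0, 3, 6}, {1, 2, 6}}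

namespace PointLinePlane

/-- The triple is a hypergraph: each line has `3` points, and each plane has `7` points, among which
the lines are the six lines of the configuration `planeLines`. -/
structure IsHypergraph (H : PointLinePlane.{u}) : Prop where
  line_card : ∀ l ∈ H.lines, l.ncard = 3
  plane_config : ∀ t ∈ H.planes, ∃ f : Fin 7 → H.Point, Function.Injective f ∧ Set.range f = t ∧
    ∀ l, l ⊆ t → (l ∈ H.lines ↔ ∃ m ∈ planeLines, l = f '' m)

/-- Isomorphism of hypergraphs: a bijection of the points that preserves and reflects lines and
planes. -/
def Isomorphic (H K : PointLinePlane.{u}) : Prop :=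
  ∃ f : H.Point ≃ K.Point,
    (∀ l, l ∈ H.lines ↔ f '' l ∈ K.lines) ∧ ∀ t, t ∈ H.planes ↔ f '' t ∈ K.planes

/-- The poset of a hypergraph: its elements are a least element `⊥`, the points, the lines and the
planes. Each element is represented by the set of points beneath it (`∅` for `⊥` and `{p}` for the
point `p`), and the order is inclusion of these sets. -/
abbrev Faces (H : PointLinePlane.{u}) : Type u :=
  {s : Set H.Point // s = ∅ ∨ (∃ p, s = {p}) ∨ s ∈ H.lines ∨ s ∈ H.planes}

instance (H : PointLinePlane.{u}) : OrderBot H.Faces where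
  bot := ⟨∅, Or.inl rfl⟩
  bot_le s := Set.empty_subset s.1

end PointLinePlane

/-- The hypergraph `G(A)` of an orthoalgebra: the points are the atoms of `BSub(A)`, and the lines
and planes are the sets of atoms under the elements of `BSub(A)` of height `2` and `3`. -/
def hypergraph (A : Type u) [OrthoStruct A] [IsOrthoalgebra A] : PointLinePlane.{u} where
  Point := {p : BSub A // IsAtom p}
  lines := {l | ∃ w : BSub A, Order.height w = 2 ∧ l = {p | p.1 ≤ w}}
  planes := {t | ∃ w : BSub A, Order.height w = 3 ∧ t = {p | p.1 ≤ w}}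

end Ortho

/-! If `1 ≠ 0`, a Boolean subalgebra of finite height `n` is generated by a partition of `1` into `n
+ 1` nonzero orthogonal elements (`exists_partition_of_height`), so elements of height at most `3`
are finite combinatorics. The atoms under such a subalgebra are the nontrivial sets of blocks up to
complement: three for a line, seven for a plane. The lines in a plane are the coarsenings of its
four blocks to three. Since each `a` lies in `{0, 1, a, a'}`, a Boolean subalgebra is determined by
the atoms below it. This gives the hypergraph and the isomorphism with its poset of faces.

The subalgebra `{0, 1, a, a'}` remembers `a` only up to complement, and a direction supplies the
missing bit. The ideal below `w` is the lattice of subalgebras of a Boolean algebra, in which a dual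
modular subalgebra containing `a` contains the principal ideal of `a` or that of `a'`
(`BoolSub.pr_le_or_pr_compl_le`). Hence the principal pairs for `{0, 1, a, a'}` are the two ideal
subalgebras of `a` and `a'`, in either order, and a direction chooses one of the two orders at each
place. The choice passes to smaller places. If two places disagreed, covers of the base below them
would have a common upper bound, either by the join axiom of directions or by
`BSubStar.exists_join`, and the choice made there would contradict one of the two
(`BSubStar.dir_apply_ne`). So every direction has the form `dir a`, and properness makes `a` unique
by providing a place strictly above the base.

A sum `a ⊕ b = c` with `a, b ≠ 0` and `c ≠ 1` amounts to a partition `{a, b, c'}`. In the subalgebra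
of height `2` that it generates, `a` and `b` are atoms and `c` is a coatom, which is what the sum of
directions records (`BSubStar.isSum_dir_iff`). All notions are invariant under order isomorphism, so
the result carries over to the posets of hypergraphs. -/

namespace Ortho

open OrthoStruct

/-! ### Sums in an orthoalgebra -/

/-- The elements of `A` together with an absorbing element for undefined sums. -/
def OSum (A : Type u) : Type u := Option A

namespace OSum

/-- The inclusion of the defined values. -/
def of {A : Type u} (a : A) : OSum A := some a

theorem of_injective {A : Type u} : Function.Injective (of : A → OSum A) :=
  Option.some_injective A

variable {A : Type u} [OrthoStruct A]

instance : Zero (OSum A) := ⟨of 0⟩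

instance : Add (OSum A) :=
  ⟨fun x y => Option.bind x fun a => Option.bind y fun b => oplus a b⟩

theorem of_add_eq_iff {a b c : A} : of a + of b = of c ↔ oplus a b = some c := Iff.rfl

theorem exists_of_add_eq {x y : OSum A} {c : A} (h : x + y = of c) :
    ∃ a b, x = of a ∧ y = of b ∧ oplus a b = some c := by
  cases x with
  | none => exact absurd h (by rintro ⟨⟩)
  | some a =>
    cases y with
    | none => exact absurd h (by rintro ⟨⟩)
    | some b => exact ⟨a, b, rfl, rfl, h⟩

variable [IsOrthoalgebra A]

theorem add_comm' (x y : OSum A) : x + y = y + x := by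
  cases x with
  | none => cases y <;> rfl
  | some a =>
    cases y with
    | none => rfl
    | some b => exact IsOrthoalgebra.comm a b

theorem add_assoc' (x y z : OSum A) : x + y + z = x + (y + z) := by
  cases x with
  | none => rfl
  | some a =>
    cases y with
    | none => rfl
    | some b =>
      cases z with
      | none =>
        change Option.bind (oplus a b) (fun _ => none) = none
        cases oplus a b <;> rfl
      | some c => exact IsOrthoalgebra.assoc a b c

theorem add_zero' (x : OSum A) : x + 0 = x := by
  cases x with
  | none => rfl
  | some a => exact oplus_zero a

/-- This structure makes finite sums and free rearrangement available. An equation with right side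
`of c` also asserts that every sum on the left is defined. -/
instance : AddCommMonoid (OSum A) where
  add_assoc := add_assoc'
  zero_add x := by rw [add_comm', add_zero']
  add_zero := add_zero'
  add_comm := add_comm'
  nsmul := nsmulRec

omit [IsOrthoalgebra A] in
theorem of_zero : (of 0 : OSum A) = 0 := rfl

theorem of_add_compl (a : A) : of a + of aᶜ = of 1 := IsOrthoalgebra.oplus_compl a

theorem eq_zero_of_add_self {a c : A} (h : of a + of a = of c) : a = 0 :=
  (IsOrthoalgebra.oplus_self a).1 ⟨c, h⟩

theorem eq_compl_of_add_eq_one {a b : A} (h : of a + of b = of 1) : b = aᶜ :=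
  IsOrthoalgebra.compl_unique a b h

/-- Writing `1 = a + a'` turns `a + 1` into `(a + a) + a'`, so `a + a` is defined. -/
theorem eq_zero_of_add_one {a c : A} (h : of a + of 1 = of c) : a = 0 := by
  rw [← of_add_compl a, ← add_assoc] at h
  obtain ⟨d, -, hd, -⟩ := exists_of_add_eq h
  exact eq_zero_of_add_self hd

/-- Adding `1` shows that `b + 1` is defined, so `b = 0`. -/
theorem eq_zero_of_add_eq_zero {a b : A} (h : of a + of b = of 0) : a = 0 := by
  have h1 : of a + (of b + of 1) = of 1 := by rw [← add_assoc, h, of_zero, zero_add]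
  obtain ⟨-, c, -, hc, -⟩ := exists_of_add_eq h1
  rw [eq_zero_of_add_one hc, of_zero, add_zero] at h
  exact of_injective h

theorem sum_eq_of_subset {ι : Type v} [DecidableEq ι] {t : ι → A} {S T : Finset ι} {c : A}
    (hST : S ⊆ T) (h : ∑ i ∈ T, of (t i) = of c) : ∃ d, ∑ i ∈ S, of (t i) = of d := by
  rw [← Finset.sdiff_union_of_subset hST, Finset.sum_union Finset.sdiff_disjoint] at h
  obtain ⟨-, d, -, hd, -⟩ := exists_of_add_eq h
  exact ⟨d, hd⟩

end OSum

open OSum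

theorem compl_eq_iff {A : Type u} [OrthoStruct A] [IsOrthoalgebra A] {a b : A} :
    aᶜ = b ↔ a = bᶜ :=
  ⟨fun h => by rw [← h, compl_compl'], fun h => by rw [h, compl_compl']⟩

theorem eq_zero_of_one_eq_zero {A : Type u} [OrthoStruct A] [IsOrthoalgebra A]
    (h : (1 : A) = 0) (a : A) : a = 0 := by
  have := of_add_compl a
  rw [h] at this
  exact eq_zero_of_add_eq_zero this

/-! ### Embeddings of Boolean algebras -/

/-- The map `f` embeds the Boolean algebra `B` into the orthoalgebra `A`. -/
structure IsEmb {A : Type u} [OrthoStruct A] {B : Type v} [BooleanAlgebra B] (f : B → A) :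
    Prop where
  map_top : f ⊤ = 1
  map_sup : ∀ a b, Disjoint a b → of (f a) + of (f b) = of (f (a ⊔ b))
  eq_bot : ∀ a, f a = 0 → a = ⊥

namespace IsEmb

variable {A : Type u} [OrthoStruct A] [IsOrthoalgebra A] {B : Type v} [BooleanAlgebra B]
  {f : B → A} (hf : IsEmb f)
include hf

theorem map_bot : f ⊥ = 0 := by
  have := hf.map_sup ⊥ ⊥ disjoint_bot_left
  exact eq_zero_of_add_self this

theorem map_compl (a : B) : f aᶜ = (f a)ᶜ := by
  apply eq_compl_of_add_eq_one
  rw [hf.map_sup _ _ disjoint_compl_right, sup_compl_eq_top, hf.map_top]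

/-- If both elements are split along `a ⊓ b`, the element `f (a ⊓ b)` occurs twice in a defined sum,
hence is zero. Thus orthogonality in `A` is the same as disjointness in `B`. -/
theorem disjoint {a b : B} {c : A} (h : of (f a) + of (f b) = of c) : Disjoint a b := by
  rw [disjoint_iff]
  apply hf.eq_bot
  have ha := hf.map_sup (a ⊓ b) (a \ b) disjoint_inf_sdiff
  have hb := hf.map_sup (a ⊓ b) (b \ a) (by rw [inf_comm]; exact disjoint_inf_sdiff)
  rw [sup_inf_sdiff] at ha
  rw [inf_comm, sup_inf_sdiff, inf_comm] at hb
  rw [← ha, ← hb, add_add_add_comm] at h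
  obtain ⟨d, -, hd, -⟩ := exists_of_add_eq h
  exact eq_zero_of_add_self hd

/-- If `f a = f b`, then `f a + f bᶜ = 1` is defined, so `a` is disjoint from `bᶜ`. -/
theorem injective : Function.Injective f := by
  have key : ∀ a b, f a = f b → a ≤ b := fun a b h => by
    rw [← compl_compl b, le_compl_iff_disjoint_right]
    exact hf.disjoint (c := 1) (by rw [h, hf.map_compl, of_add_compl])
  exact fun a b h => le_antisymm (key a b h) (key b a h.symm)

theorem add_eq_iff {a b c : B} :
    of (f a) + of (f b) = of (f c) ↔ Disjoint a b ∧ a ⊔ b = c := by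
  constructor
  · intro h
    have hd := hf.disjoint h
    rw [hf.map_sup _ _ hd] at h
    exact ⟨hd, hf.injective (of_injective h)⟩
  · rintro ⟨h, rfl⟩
    exact hf.map_sup _ _ h

theorem exists_add_iff {a b : B} : (∃ c, of (f a) + of (f b) = of c) ↔ Disjoint a b :=
  ⟨fun ⟨_, h⟩ => hf.disjoint h, fun h => ⟨_, hf.map_sup _ _ h⟩⟩

/-- The range of an embedding. -/
def subalg : Subalg A where
  carrier := Set.range f
  zero_mem := ⟨⊥, hf.map_bot⟩
  one_mem := ⟨⊤, hf.map_top⟩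
  compl_mem := by
    rintro _ ⟨a, rfl⟩
    exact ⟨aᶜ, hf.map_compl a⟩
  oplus_mem := by
    rintro _ ⟨a, rfl⟩ _ ⟨b, rfl⟩ c h
    have h' : of (f a) + of (f b) = of c := h
    rw [hf.map_sup _ _ (hf.disjoint h')] at h'
    exact ⟨_, of_injective h'⟩

/-- The Boolean subalgebra that is the range of an embedding. -/
noncomputable def bsub : BSub A where
  toSubalg := hf.subalg
  isBoolean := by
    have e : ∃ e : hf.subalg.carrier ≃ B, ∀ x, f (e x) = x :=
      ⟨(Equiv.ofInjective f hf.injective).symm, fun x =>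
        congrArg Subtype.val ((Equiv.ofInjective f hf.injective).apply_symm_apply x)⟩
    obtain ⟨e, he⟩ := e
    -- `IsBoolean` asks for a Boolean algebra in the universe of `A`, so the structure of `B` is
    -- transported to the range.
    let _ : BooleanAlgebra hf.subalg.carrier := e.booleanAlgebra
    refine ⟨hf.subalg.carrier, e.booleanAlgebra, Equiv.refl _, ?_, ?_, fun a => ?_,
      fun a b c => ?_⟩
    · apply e.injective
      change e 0 = e (e.symm ⊥)
      rw [e.apply_symm_apply]
      exact hf.injective ((he 0).trans hf.map_bot.symm)
    · apply e.injective
      change e 1 = e (e.symm ⊤)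
      rw [e.apply_symm_apply]
      exact hf.injective ((he 1).trans hf.map_top.symm)
    · apply e.injective
      change e aᶜ = e (e.symm (e a)ᶜ)
      rw [e.apply_symm_apply]
      apply hf.injective
      rw [he, hf.map_compl, he]
      rfl
    · rw [Subalg.oplus_eq_some_iff, ← of_add_eq_iff, ← he a, ← he b, ← he c, hf.add_eq_iff]
      refine and_congr ?_ ?_
      · rw [disjoint_iff, disjoint_iff]
        change _ ↔ e.symm (e a ⊓ e b) = e.symm ⊥
        rw [e.symm.injective.eq_iff]
      · change _ ↔ e.symm (e a ⊔ e b) = c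
        rw [Equiv.symm_apply_eq]

end IsEmb

/-! ### Elements of Boolean subalgebras -/

namespace BSub

variable {A : Type u} [OrthoStruct A]

@[ext] theorem ext {x y : BSub A} (h : ∀ a, a ∈ x.carrier ↔ a ∈ y.carrier) : x = y :=
  carrier_injective (Set.ext h)

variable (w : BSub A)

theorem zero_mem : 0 ∈ w.carrier := w.toSubalg.zero_mem

theorem one_mem : 1 ∈ w.carrier := w.toSubalg.one_mem

variable {w}

theorem compl_mem {a : A} (h : a ∈ w.carrier) : aᶜ ∈ w.carrier := w.toSubalg.compl_mem a h

theorem add_mem {a b c : A} (ha : a ∈ w.carrier) (hb : b ∈ w.carrier)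
    (h : of a + of b = of c) : c ∈ w.carrier := w.toSubalg.oplus_mem a ha b hb c h

variable [IsOrthoalgebra A]

theorem compl_mem_iff {a : A} : aᶜ ∈ w.carrier ↔ a ∈ w.carrier :=
  ⟨fun h => by simpa [compl_compl'] using compl_mem h, compl_mem⟩

theorem mem_bot {a : A} : a ∈ (⊥ : BSub A).carrier ↔ a = 0 ∨ a = 1 := Iff.rfl

omit [IsOrthoalgebra A] in
-- Converse of `IsEmb.bsub`: it turns a question inside a Boolean subalgebra into one in a genuine
-- Boolean algebra.
theorem exists_isEmb (w : BSub A) :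
    ∃ (B : Type u) (_ : BooleanAlgebra B) (f : B → A), IsEmb f ∧ Set.range f = w.carrier := by
  obtain ⟨B, hB, g, h0, h1, hc, hs⟩ := w.isBoolean
  refine ⟨B, hB, fun b => g.symm b, ⟨?_, fun a b h => ?_, fun a h => ?_⟩, ?_⟩
  · rw [← h1, g.symm_apply_apply]
    rfl
  · have := (hs (g.symm a) (g.symm b) (g.symm (a ⊔ b))).2 (by simpa using h)
    exact (Subalg.oplus_eq_some_iff _ _ _ _).1 this
  · have : g.symm a = 0 := Subtype.ext h
    rw [← h0, ← this, g.apply_symm_apply]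
  · ext a
    constructor
    · rintro ⟨b, rfl⟩
      exact (g.symm b).2
    · intro h
      exact ⟨g ⟨a, h⟩, by simp⟩

theorem sum_mem {ι : Type v} {t : ι → A} {S : Finset ι} {c : A}
    (ht : ∀ i ∈ S, t i ∈ w.carrier) (h : ∑ i ∈ S, of (t i) = of c) : c ∈ w.carrier := by
  classical
  induction S using Finset.induction_on generalizing c with
  | empty =>
    rw [← of_injective h]
    exact w.zero_mem
  | insert i S hi ih =>
    rw [Finset.sum_insert hi] at h
    obtain ⟨a, b, ha, hb, hab⟩ := exists_of_add_eq h
    refine add_mem (ht i (by simp)) (ih (fun j hj => ht j (by simp [hj])) hb) ?_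
    rw [← hb]
    exact h

end BSub

end Ortho

namespace Ortho

/-! ### Dual modular subalgebras of a Boolean algebra -/

section Lattice

theorem isGLB_pair_inf {X : Type u} [Lattice X] (a b : X) : IsGLB {a, b} (a ⊓ b) := isGLB_pair

theorem isLUB_pair_sup {X : Type u} [Lattice X] (a b : X) : IsLUB {a, b} (a ⊔ b) := isLUB_pair

theorem isGLB_pair_iff {X : Type u} [Lattice X] {a b c : X} : IsGLB {a, b} c ↔ a ⊓ b = c :=
  ⟨fun h => (isGLB_pair_inf a b).unique h, fun h => h ▸ isGLB_pair_inf a b⟩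

theorem isLUB_pair_iff {X : Type u} [Lattice X] {a b c : X} : IsLUB {a, b} c ↔ a ⊔ b = c :=
  ⟨fun h => (isLUB_pair_sup a b).unique h, fun h => h ▸ isLUB_pair_sup a b⟩

theorem isDualModular_iff {X : Type u} [Lattice X] {u : X} :
    IsDualModular u ↔ (∀ p q, u ≤ q → u ⊔ (p ⊓ q) = (u ⊔ p) ⊓ q) ∧
      ∀ p q, p ≤ q → p ⊔ (u ⊓ q) = (p ⊔ u) ⊓ q := by
  simp only [IsDualModular, isGLB_pair_iff, isLUB_pair_iff]
  constructor
  · exact fun h => ⟨fun p q hq => h.1 p q _ _ _ hq rfl rfl rfl,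
      fun p q hq => h.2 p q _ _ _ hq rfl rfl rfl⟩
  · rintro ⟨h1, h2⟩
    constructor
    · rintro p q _ _ _ hq rfl rfl rfl
      exact h1 p q hq
    · rintro p q _ _ _ hq rfl rfl rfl
      exact h2 p q hq

end Lattice

namespace BoolSub

variable {B : Type u} [BooleanAlgebra B]

/-- The subalgebra `{⊥, ⊤, a, aᶜ}`. -/
def sg (a : B) : BooleanSubalgebra B where
  carrier := {x | x = ⊥ ∨ x = ⊤ ∨ x = a ∨ x = aᶜ}
  supClosed' := by
    rintro x (rfl | rfl | rfl | rfl) y (rfl | rfl | rfl | rfl) <;> simp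
  infClosed' := by
    rintro x (rfl | rfl | rfl | rfl) y (rfl | rfl | rfl | rfl) <;> simp
  compl_mem' := by
    rintro x (rfl | rfl | rfl | rfl) <;> simp
  bot_mem' := by simp

theorem mem_sg {a x : B} : x ∈ sg a ↔ x = ⊥ ∨ x = ⊤ ∨ x = a ∨ x = aᶜ := Iff.rfl

theorem self_mem_sg (a : B) : a ∈ sg a := by simp [mem_sg]

theorem sg_le {a : B} {S : BooleanSubalgebra B} : sg a ≤ S ↔ a ∈ S := by
  refine ⟨fun h => h (self_mem_sg a), fun h x hx => ?_⟩
  rcases hx with rfl | rfl | rfl | rfl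
  · exact BooleanSubalgebra.bot_mem
  · exact BooleanSubalgebra.top_mem
  · exact h
  · exact BooleanSubalgebra.compl_mem h

theorem sg_compl (a : B) : sg aᶜ = sg a := by
  refine SetLike.ext fun x => ?_
  simp only [mem_sg, compl_compl]
  tauto

theorem isBasic_sg (a : B) : IsBasic (sg a) := by
  rw [IsBasic, or_iff_not_imp_left]
  refine fun h => ⟨h, fun S hS => ?_⟩
  rw [eq_bot_iff]
  intro x hx
  rcases hS.le hx with rfl | rfl | rfl | rfl
  · exact Or.inl rfl
  · exact Or.inr rfl
  · exact absurd (sg_le.2 hx) (not_le_of_gt hS)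
  · exact absurd (sg_le.2 (BooleanSubalgebra.compl_mem_iff.1 hx)) (not_le_of_gt hS)

/-- The subalgebra consisting of the principal ideal of `a` and the complements of its elements. -/
def pr (a : B) : BooleanSubalgebra B where
  carrier := {x | x ≤ a ∨ xᶜ ≤ a}
  supClosed' := by
    rintro x (hx | hx) y (hy | hy)
    · exact Or.inl (sup_le hx hy)
    · exact Or.inr (by rw [compl_sup]; exact inf_le_right.trans hy)
    · exact Or.inr (by rw [compl_sup]; exact inf_le_left.trans hx)
    · exact Or.inr (by rw [compl_sup]; exact inf_le_left.trans hx)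
  infClosed' := by
    rintro x (hx | hx) y (hy | hy)
    · exact Or.inl (inf_le_left.trans hx)
    · exact Or.inl (inf_le_left.trans hx)
    · exact Or.inl (inf_le_right.trans hy)
    · exact Or.inr (by rw [compl_inf]; exact sup_le hx hy)
  compl_mem' := by
    rintro x (hx | hx)
    · exact Or.inr (by rwa [compl_compl])
    · exact Or.inl hx
  bot_mem' := Or.inl bot_le

theorem mem_pr {a x : B} : x ∈ pr a ↔ x ≤ a ∨ xᶜ ≤ a := Iff.rfl

theorem self_mem_pr (a : B) : a ∈ pr a := Or.inl le_rfl

theorem pr_le {a : B} {S : BooleanSubalgebra B} : pr a ≤ S ↔ ∀ x ≤ a, x ∈ S := by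
  refine ⟨fun h x hx => h (Or.inl hx), fun h x hx => ?_⟩
  rcases hx with hx | hx
  · exact h x hx
  · exact BooleanSubalgebra.compl_mem_iff.1 (h _ hx)

/-- The elements whose trace on `e` is the trace of an element of `S`. -/
def trace (e : B) (S : BooleanSubalgebra B) : BooleanSubalgebra B where
  carrier := {x | ∃ c ∈ S, x ⊓ e = c ⊓ e}
  supClosed' := by
    rintro x ⟨c, hc, h⟩ y ⟨d, hd, h'⟩
    exact ⟨c ⊔ d, BooleanSubalgebra.sup_mem hc hd, by rw [inf_sup_right, inf_sup_right, h, h']⟩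
  infClosed' := by
    rintro x ⟨c, hc, h⟩ y ⟨d, hd, h'⟩
    exact ⟨c ⊓ d, BooleanSubalgebra.inf_mem hc hd, by
      rw [inf_inf_distrib_right x y e, h, h', ← inf_inf_distrib_right]⟩
  compl_mem' := by
    rintro x ⟨c, hc, h⟩
    refine ⟨cᶜ, BooleanSubalgebra.compl_mem hc, ?_⟩
    have key : ∀ z : B, zᶜ ⊓ e = e \ (z ⊓ e) := fun z => by
      rw [inf_comm, ← sdiff_eq, inf_comm, sdiff_inf_self_left]
    rw [key, key, h]
  bot_mem' := ⟨⊥, BooleanSubalgebra.bot_mem, rfl⟩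

theorem le_trace (e : B) (S : BooleanSubalgebra B) : S ≤ trace e S := fun x hx => ⟨x, hx, rfl⟩

/-- Parts below `a` are free in the join, so only the trace on `aᶜ` matters: `x` is the join of `x ⊓
a`, which lies in `pr a`, and `x ⊓ aᶜ = c ⊓ aᶜ`. -/
theorem pr_sup (a : B) (p : BooleanSubalgebra B) : pr a ⊔ p = trace aᶜ p := by
  apply le_antisymm
  · refine sup_le (pr_le.2 fun x hx => ⟨⊥, BooleanSubalgebra.bot_mem, ?_⟩) (le_trace _ _)
    rw [bot_inf_eq, ← disjoint_iff, ← le_compl_iff_disjoint_right, compl_compl]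
    exact hx
  · rintro x ⟨c, hc, h⟩
    have ha : a ∈ pr a ⊔ p := le_sup_left (a := pr a) (self_mem_pr a)
    have h1 : x ⊓ a ∈ pr a ⊔ p := le_sup_left (a := pr a) (Or.inl inf_le_right)
    have h2 : c ⊓ aᶜ ∈ pr a ⊔ p := BooleanSubalgebra.inf_mem
      (le_sup_right (a := pr a) hc) (BooleanSubalgebra.compl_mem ha)
    rw [← sup_inf_inf_compl (x := x) (y := a), h]
    exact BooleanSubalgebra.sup_mem h1 h2

/-- By `pr_sup`, an element `x` of the right side agrees on `aᶜ` with some `c ∈ p`. In the first law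
`q` contains everything below `a`, so `c ∈ q` as well. In the second law `c ∈ p ≤ q`, and `x` arises
from `c` by means of the differences `x \ c` and `c \ x`, which lie in `q` and below `a`. -/
theorem isDualModular_pr (a : B) : IsDualModular (pr a) := by
  rw [isDualModular_iff]
  constructor
  · intro p q hq
    refine le_antisymm (le_inf (sup_le_sup_left inf_le_left _) (sup_le hq inf_le_right)) ?_
    rw [pr_sup, pr_sup]
    rintro x ⟨⟨c, hc, h⟩, hx⟩
    refine ⟨c, ⟨hc, ?_⟩, h⟩
    have haq : a ∈ q := hq (self_mem_pr a)
    rw [← sup_inf_inf_compl (x := c) (y := a), ← h]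
    exact BooleanSubalgebra.sup_mem (hq (Or.inl inf_le_right))
      (BooleanSubalgebra.inf_mem hx (BooleanSubalgebra.compl_mem haq))
  · intro p q hq
    refine le_antisymm (le_inf (sup_le_sup_left inf_le_left _) (sup_le hq inf_le_right)) ?_
    rw [sup_comm p, pr_sup]
    rintro x ⟨⟨c, hc, h⟩, hx⟩
    have hcq : c ∈ q := hq hc
    have key : ∀ y z : B, y ∈ q → z ∈ q → y ⊓ aᶜ = z ⊓ aᶜ → y \ z ∈ pr a ⊓ q := by
      intro y z hy hz hyz
      refine ⟨Or.inl ?_, BooleanSubalgebra.sdiff_mem hy hz⟩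
      rw [sdiff_le_iff, ← sup_inf_inf_compl (x := y) (y := a), hyz, sup_comm]
      exact sup_le_sup inf_le_left inf_le_right
    have hc' : c ∈ p ⊔ (pr a ⊓ q) := le_sup_left (a := p) hc
    have h1 := le_sup_right (a := p) (key x c hx hcq h)
    have h2 := le_sup_right (a := p) (key c x hcq hx h.symm)
    have : x = (c \ (c \ x)) ⊔ (x \ c) := by
      rw [sdiff_sdiff_right_self, inf_comm, sup_inf_sdiff]
    rw [this]
    exact BooleanSubalgebra.sup_mem (BooleanSubalgebra.sdiff_mem hc' h2) h1

/-- Suppose `b ≤ e` and `c ≤ eᶜ` are both outside `S`, and apply the first modular law to `p = sg (b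
⊔ c)` and `q = S ⊔ sg c`. The element `c = (b ⊔ c) ⊓ eᶜ` lies in `(S ⊔ p) ⊓ q`. On `e`, every
element of `q` has the trace of an element of `S`, whereas `b ⊔ c` has trace `b`; so `b ⊔ c ∉ q` and
`p ⊓ q = ⊥`. The law then puts `c` into `S`. -/
theorem pr_le_or_pr_compl_le {e : B} {S : BooleanSubalgebra B} (hS : IsDualModular S)
    (he : e ∈ S) : pr e ≤ S ∨ pr eᶜ ≤ S := by
  by_contra! h
  rw [pr_le, pr_le] at h
  push Not at h
  obtain ⟨⟨b, hb, hbS⟩, c, hc, hcS⟩ := h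
  have hce : c ⊓ e = ⊥ := by
    rw [← disjoint_iff, ← le_compl_iff_disjoint_right]
    exact hc
  have hbe : b ⊓ eᶜ = ⊥ := by
    rw [← disjoint_iff, ← le_compl_iff_disjoint_right, compl_compl]
    exact hb
  have hmod := (isDualModular_iff.1 hS).1 (sg (b ⊔ c)) (S ⊔ sg c) le_sup_left
  have h1 : c ∈ (S ⊔ sg (b ⊔ c)) ⊓ (S ⊔ sg c) := by
    refine ⟨?_, le_sup_right (a := S) (self_mem_sg c)⟩
    have hd : b ⊔ c ∈ S ⊔ sg (b ⊔ c) := le_sup_right (a := S) (self_mem_sg (b ⊔ c))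
    have he' : eᶜ ∈ S ⊔ sg (b ⊔ c) :=
      le_sup_left (a := S) (BooleanSubalgebra.compl_mem he)
    have := BooleanSubalgebra.inf_mem hd he'
    rwa [inf_sup_right, hbe, bot_sup_eq, inf_eq_left.2 hc] at this
  have h2 : b ⊔ c ∉ S ⊔ sg c := by
    intro hd
    have hle : S ⊔ sg c ≤ trace e S := sup_le (le_trace _ _)
      (sg_le.2 ⟨⊥, BooleanSubalgebra.bot_mem, by rw [hce, bot_inf_eq]⟩)
    obtain ⟨s, hs, h⟩ := hle hd
    rw [inf_sup_right, hce, sup_bot_eq, inf_eq_left.2 hb] at h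
    exact hbS (h ▸ BooleanSubalgebra.inf_mem hs he)
  have h3 : sg (b ⊔ c) ⊓ (S ⊔ sg c) = ⊥ := by
    rcases isBasic_sg (b ⊔ c) with h | h
    · rw [h, bot_inf_eq]
    · refine h.2 _ (lt_of_le_of_ne inf_le_left fun h' => h2 ?_)
      exact (h'.ge (self_mem_sg _)).2
  rw [← hmod, h3, sup_bot_eq] at h1
  exact hcS h1

theorem pr_inf_pr_compl (a : B) : pr a ⊓ pr aᶜ = sg a := by
  apply le_antisymm
  · have key : ∀ x : B, x ≤ a → xᶜ ≤ aᶜ → x = a := fun x h h' =>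
      le_antisymm h (compl_le_compl_iff_le.1 h')
    rintro x ⟨hx | hx, hx' | hx'⟩
    · left
      exact le_bot_iff.1 ((le_inf hx hx').trans (inf_compl_eq_bot (a := a)).le)
    · exact Or.inr (Or.inr (Or.inl (key x hx hx')))
    · refine Or.inr (Or.inr (Or.inr ?_))
      rw [← key xᶜ hx (by rwa [compl_compl]), compl_compl]
    · right; left
      rw [← compl_eq_bot]
      exact le_bot_iff.1 ((le_inf hx hx').trans (inf_compl_eq_bot (a := a)).le)
  · refine sg_le.2 ⟨self_mem_pr a, Or.inr le_rfl⟩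

theorem pr_sup_pr_compl (a : B) : pr a ⊔ pr aᶜ = ⊤ := by
  rw [pr_sup, eq_top_iff]
  intro x _
  exact ⟨x ⊓ aᶜ, Or.inl inf_le_right, by rw [inf_assoc, inf_idem]⟩

theorem sg_le_pr (a : B) : sg a ≤ pr a := sg_le.2 (self_mem_pr a)

/-- For `x ∈ y` the element `x ⊓ aᶜ` lies in both `y` and `z`, hence is one of `⊥`, `⊤`, `a`, `aᶜ`.
This leaves only `x ⊓ aᶜ = ⊥` or `aᶜ ≤ x`. -/
theorem eq_pr_of_inf_eq {a : B} {y z : BooleanSubalgebra B} (hyz : y ⊓ z = sg a)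
    (hy : pr a ≤ y) (hz : pr aᶜ ≤ z) : y = pr a := by
  refine le_antisymm (fun x hx => ?_) hy
  have ha : a ∈ y := hy (self_mem_pr a)
  have h : x ⊓ aᶜ ∈ sg a := by
    rw [← hyz]
    exact ⟨BooleanSubalgebra.inf_mem hx (BooleanSubalgebra.compl_mem ha), hz (Or.inl inf_le_right)⟩
  have key : x ⊓ aᶜ = ⊥ ∨ aᶜ ≤ x := by
    rcases h with h | h | h | h
    · exact Or.inl h
    · exact Or.inr (le_top.trans (h.ge.trans inf_le_left))
    · left
      have : a ≤ aᶜ := h.ge.trans inf_le_right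
      rw [h, ← inf_eq_left.2 this, inf_compl_eq_bot]
    · exact Or.inr (h.ge.trans inf_le_left)
  rcases key with h | h
  · left
    rwa [← disjoint_iff, ← le_compl_iff_disjoint_right, compl_compl] at h
  · exact Or.inr (compl_le_iff_compl_le.1 h)

/-- The subalgebra `sg a` is also contained in `pr aᶜ`, so the join `pr a ⊔ pr aᶜ = ⊤` collapses to
`pr aᶜ`. -/
theorem pr_compl_eq_top {a : B} (h : pr a = sg a) : pr aᶜ = ⊤ := by
  rw [← pr_sup_pr_compl a, h, eq_comm, sup_eq_right, ← sg_compl]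
  exact sg_le_pr _

/-- The principal pairs for a basic subalgebra are given by the principal ideals of its
generators. -/
theorem isPrincipalPairFor_iff {a : B} {y z : BooleanSubalgebra B} :
    IsPrincipalPairFor (sg a) y z ↔ (y = pr a ∧ z = pr aᶜ) ∨ (y = pr aᶜ ∧ z = pr a) := by
  constructor
  · rintro ⟨⟨hy, hz, h⟩, hyz⟩
    rw [isGLB_pair_iff] at hyz
    have hay : a ∈ y := (hyz.ge (self_mem_sg a)).1
    have haz : a ∈ z := (hyz.ge (self_mem_sg a)).2
    -- This treats the cases in which one component is `⊤`: the other one is then the meet `sg a`.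
    have hS : ∀ {S : BooleanSubalgebra B}, S ≤ sg a → IsDualModular S → a ∈ S →
        (S = pr a ∧ pr aᶜ = ⊤) ∨ (S = pr aᶜ ∧ pr a = ⊤) := by
      intro S hSa hS ha
      rcases pr_le_or_pr_compl_le hS ha with h | h
      · have := le_antisymm (h.trans hSa) (sg_le_pr a)
        exact Or.inl ⟨le_antisymm (hSa.trans this.ge) h, pr_compl_eq_top this⟩
      · have h' := h.trans hSa
        rw [← sg_compl] at hSa h'
        have := le_antisymm h' (sg_le_pr aᶜ)
        have ht := pr_compl_eq_top this
        rw [compl_compl] at ht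
        exact Or.inr ⟨le_antisymm (hSa.trans this.ge) h, ht⟩
    rcases h with ⟨rfl, -⟩ | ⟨rfl, -⟩ | ⟨-, x, hx, -, hxm⟩
    · rw [top_inf_eq] at hyz
      rcases hS hyz.le hz haz with ⟨h1, h2⟩ | ⟨h1, h2⟩
      · exact Or.inr ⟨h2.symm, h1⟩
      · exact Or.inl ⟨h2.symm, h1⟩
    · rw [inf_top_eq] at hyz
      rcases hS hyz.le hy hay with ⟨h1, h2⟩ | ⟨h1, h2⟩
      · exact Or.inl ⟨h1, h2.symm⟩
      · exact Or.inr ⟨h1, h2.symm⟩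
    · rw [isGLB_pair_iff, hyz] at hx
      subst hx
      have hyz' : z ⊓ y = sg a := by rwa [inf_comm]
      -- If both components contained the same ideal subalgebra, their meet `sg a` would equal it
      -- and be dual modular, which the third kind of principal pair excludes.
      have hpr : ∀ b, sg b = sg a → ¬ (pr b ≤ y ∧ pr b ≤ z) := by
        rintro b hb ⟨h1, h2⟩
        apply hxm
        rw [← hb, le_antisymm (sg_le_pr b) ((le_inf h1 h2).trans (hyz.trans hb.symm).le)]
        exact isDualModular_pr b
      rcases pr_le_or_pr_compl_le hy hay with h1 | h1 <;>
        rcases pr_le_or_pr_compl_le hz haz with h2 | h2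
      · exact absurd ⟨h1, h2⟩ (hpr a rfl)
      · refine Or.inl ⟨eq_pr_of_inf_eq hyz h1 h2, eq_pr_of_inf_eq (z := y) ?_ h2 ?_⟩
        · rw [hyz', sg_compl]
        · rwa [compl_compl]
      · refine Or.inr ⟨eq_pr_of_inf_eq (z := z) ?_ h1 ?_, eq_pr_of_inf_eq hyz' h2 h1⟩
        · rw [hyz, sg_compl]
        · rwa [compl_compl]
      · exact absurd ⟨h1, h2⟩ (hpr aᶜ (sg_compl a))
  · have key : ∀ a : B, IsPrincipalPairFor (sg a) (pr a) (pr aᶜ) := by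
      intro a
      refine ⟨⟨isDualModular_pr a, isDualModular_pr aᶜ, ?_⟩,
        isGLB_pair_iff.2 (pr_inf_pr_compl a)⟩
      -- If `sg a` is dual modular, it equals `pr a` or `pr aᶜ`, and the other component is `⊤`;
      -- otherwise the third kind of principal pair applies.
      by_cases h : IsDualModular (sg a)
      · rcases pr_le_or_pr_compl_le h (self_mem_sg a) with h | h
        · have h := le_antisymm h (sg_le_pr a)
          exact Or.inr (Or.inl ⟨pr_compl_eq_top h, h ▸ isBasic_sg a⟩)
        · rw [← sg_compl] at h
          have h := le_antisymm h (sg_le_pr aᶜ)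
          have ht := pr_compl_eq_top h
          rw [compl_compl] at ht
          exact Or.inl ⟨ht, h ▸ isBasic_sg aᶜ⟩
      · exact Or.inr (Or.inr ⟨isLUB_pair_iff.2 (pr_sup_pr_compl a), sg a,
          isGLB_pair_iff.2 (pr_inf_pr_compl a), isBasic_sg a, h⟩)
    rintro (⟨rfl, rfl⟩ | ⟨rfl, rfl⟩)
    · exact key a
    · exact (key a).symm

end BoolSub

end Ortho

namespace Ortho

open OrthoStruct OSum

/-! ### Invariance under order isomorphisms -/

section OrderIso

variable {X : Type u} {Y : Type v} [PartialOrder X] [PartialOrder Y] (e : X ≃o Y)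

theorem isGLB_pair_orderIso {a b c : X} : IsGLB {e a, e b} (e c) ↔ IsGLB {a, b} c := by
  rw [← Set.image_pair, e.isGLB_image']

theorem isLUB_pair_orderIso {a b c : X} : IsLUB {e a, e b} (e c) ↔ IsLUB {a, b} c := by
  rw [← Set.image_pair, e.isLUB_image']

theorem isDualModular_orderIso {x : X} : IsDualModular (e x) ↔ IsDualModular x := by
  simp only [IsDualModular, e.surjective.forall, isGLB_pair_orderIso, isLUB_pair_orderIso,
    e.le_iff_le]

theorem isBasic_orderIso [OrderBot X] [OrderBot Y] {x : X} : IsBasic (e x) ↔ IsBasic x := by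
  rw [IsBasic, IsBasic, e.isAtom_iff, ← e.map_bot, e.injective.eq_iff]

theorem isPrincipalPairFor_orderIso [BoundedOrder X] [BoundedOrder Y] {x y z : X} :
    IsPrincipalPairFor (e x) (e y) (e z) ↔ IsPrincipalPairFor x y z := by
  simp only [IsPrincipalPairFor, IsPrincipalPair, isGLB_pair_orderIso, isDualModular_orderIso,
    isBasic_orderIso, e.surjective.exists]
  rw [← e.map_top, isLUB_pair_orderIso, e.injective.eq_iff, e.injective.eq_iff]

end OrderIso

variable {A : Type u} [OrthoStruct A] [IsOrthoalgebra A]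

/-! ### Boolean subalgebras in the range of an embedding -/

namespace IsEmb

variable {B : Type v} [BooleanAlgebra B] {f : B → A} (hf : IsEmb f)
include hf

/-- A priori `y` and `B` share only sums and complements, not meets. Splitting the two elements
along their meet in the Boolean algebra of `y` gives `a = e ⊔ s'` and `b = e ⊔ t'` in `B`. There
`s'` and `t'` are disjoint because their sum is defined, so `a ⊓ b = e` by distributivity. -/
theorem inf_mem {y : BSub A} (hy : y.carrier ⊆ Set.range f) {a b : B} (ha : f a ∈ y.carrier)
    (hb : f b ∈ y.carrier) : f (a ⊓ b) ∈ y.carrier := by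
  obtain ⟨C, _, g, hg, hgy⟩ := y.exists_isEmb
  have hgf : ∀ c, ∃ d, f d = g c := fun c => hy (hgy ▸ Set.mem_range_self c)
  rw [← hgy] at ha hb
  obtain ⟨s, hs⟩ := ha
  obtain ⟨t, ht⟩ := hb
  obtain ⟨e, he⟩ := hgf (s ⊓ t)
  obtain ⟨s', hs'⟩ := hgf (s \ t)
  obtain ⟨t', ht'⟩ := hgf (t \ s)
  have h1 := hg.map_sup (s ⊓ t) (s \ t) disjoint_inf_sdiff
  have h2 := hg.map_sup (s ⊓ t) (t \ s) (by rw [inf_comm]; exact disjoint_inf_sdiff)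
  have h3 := hg.map_sup (s \ t) (t \ s) disjoint_sdiff_sdiff
  rw [sup_inf_sdiff, ← he, ← hs', hs, hf.add_eq_iff] at h1
  rw [inf_comm, sup_inf_sdiff, inf_comm, ← he, ← ht', ht, hf.add_eq_iff] at h2
  rw [← hs', ← ht'] at h3
  have h3 := hf.disjoint h3
  have : a ⊓ b = e := by
    rw [← h1.2, ← h2.2, ← sup_inf_left, disjoint_iff.1 h3, sup_bot_eq]
  rw [this, he, ← hgy]
  exact Set.mem_range_self _

/-- The subalgebra of `B` corresponding to a Boolean subalgebra of `A` in the range of `f`. -/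
def comap (y : BSub A) (hy : y.carrier ⊆ Set.range f) : BooleanSubalgebra B where
  carrier := {b | f b ∈ y.carrier}
  infClosed' := fun a ha b hb => hf.inf_mem hy ha hb
  supClosed' := fun a ha b hb => by
    have h : ∀ c, f c ∈ y.carrier → f cᶜ ∈ y.carrier := fun c hc => by
      rw [hf.map_compl]
      exact BSub.compl_mem hc
    have := h _ (hf.inf_mem hy (h a ha) (h b hb))
    rwa [compl_inf, compl_compl, compl_compl] at this
  compl_mem' := fun {c} hc => by
    change f cᶜ ∈ y.carrier
    rw [hf.map_compl]
    exact BSub.compl_mem hc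
  bot_mem' := by
    change f ⊥ ∈ y.carrier
    rw [hf.map_bot]
    exact y.zero_mem

omit [IsOrthoalgebra A] in
theorem comp_subtype (S : BooleanSubalgebra B) : IsEmb fun b : S => f b where
  map_top := hf.map_top
  map_sup a b h := hf.map_sup a b (by
    rw [disjoint_iff] at h ⊢
    exact congrArg Subtype.val h)
  eq_bot a h := Subtype.ext (hf.eq_bot _ h)

/-- The Boolean subalgebra of `A` that is the image of a subalgebra of `B`. -/
noncomputable def map (S : BooleanSubalgebra B) : BSub A := (hf.comp_subtype S).bsub

theorem mem_map {S : BooleanSubalgebra B} {a : A} :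
    a ∈ (hf.map S).carrier ↔ ∃ b ∈ S, f b = a := by
  constructor
  · rintro ⟨b, rfl⟩
    exact ⟨b, b.2, rfl⟩
  · rintro ⟨b, hb, rfl⟩
    exact ⟨⟨b, hb⟩, rfl⟩

theorem apply_mem_map {S : BooleanSubalgebra B} {b : B} : f b ∈ (hf.map S).carrier ↔ b ∈ S := by
  rw [hf.mem_map]
  exact ⟨fun ⟨c, hc, h⟩ => hf.injective h ▸ hc, fun h => ⟨b, h, rfl⟩⟩

/-- The Boolean subalgebras of `A` of height at most `3` in the range of `f` correspond to the
subalgebras of `B`. -/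
noncomputable def iicEquiv {w : BSubStar A} (hw : Set.range f = w.1.carrier) :
    Set.Iic w ≃o BooleanSubalgebra B where
  toFun y := hf.comap y.1.1 (hw ▸ y.2)
  invFun S := ⟨⟨hf.map S, (Order.height_mono (by
      rintro _ ⟨b, rfl⟩
      exact hw.le (Set.mem_range_self _))).trans w.2⟩, by
      rintro _ ⟨b, rfl⟩
      exact hw.le (Set.mem_range_self _)⟩
  left_inv y := by
    refine Subtype.ext (Subtype.ext (BSub.ext fun a => ?_))
    change a ∈ (hf.map _).carrier ↔ _
    rw [hf.mem_map]
    constructor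
    · rintro ⟨b, hb, rfl⟩
      exact hb
    · intro ha
      obtain ⟨b, rfl⟩ : a ∈ Set.range f := hw ▸ y.2 ha
      exact ⟨b, ha, rfl⟩
  right_inv S := SetLike.ext fun b => hf.apply_mem_map
  map_rel_iff' := by
    intro y z
    constructor
    · intro h a ha
      obtain ⟨b, rfl⟩ : a ∈ Set.range f := hw ▸ y.2 ha
      exact h ha
    · exact fun h b hb => h hb

end IsEmb

/-! ### Partitions of unity -/

/-- Partitions of the unit element into nonzero orthogonal elements. -/
structure IsPartition {ι : Type v} [Fintype ι] (t : ι → A) : Prop where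
  sum_eq : ∑ i, of (t i) = of 1
  ne_zero : ∀ i, t i ≠ 0

namespace IsPartition

variable {ι : Type v} [Fintype ι] [DecidableEq ι] {t : ι → A} (ht : IsPartition t)

/-- The partial sums of a partition. -/
noncomputable def map (S : Finset ι) : A :=
  (sum_eq_of_subset (Finset.subset_univ S) ht.sum_eq).choose

include ht

theorem sum_eq_map (S : Finset ι) : ∑ i ∈ S, of (t i) = of (ht.map S) :=
  (sum_eq_of_subset (Finset.subset_univ S) ht.sum_eq).choose_spec

theorem map_singleton (i : ι) : ht.map {i} = t i := by
  apply of_injective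
  rw [← ht.sum_eq_map, Finset.sum_singleton]

/-- The only nonzero partial sums that could be lost are excluded because a vanishing defined sum
has vanishing terms. -/
theorem isEmb : IsEmb ht.map where
  map_top := by
    apply of_injective
    rw [← ht.sum_eq_map]
    exact ht.sum_eq
  map_sup S T h := by
    rw [← ht.sum_eq_map, ← ht.sum_eq_map, ← ht.sum_eq_map, Finset.sup_eq_union,
      Finset.sum_union h]
  eq_bot S h := by
    rw [Finset.bot_eq_empty, Finset.eq_empty_iff_forall_notMem]
    intro i hi
    have h1 := ht.sum_eq_map S
    rw [h, ← Finset.add_sum_erase _ _ hi] at h1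
    obtain ⟨-, c, -, hc, -⟩ := exists_of_add_eq h1
    rw [hc] at h1
    exact ht.ne_zero i (eq_zero_of_add_eq_zero h1)

/-- The Boolean subalgebra generated by a partition. -/
noncomputable def gen : BSub A := ht.isEmb.bsub

theorem apply_mem_gen (i : ι) : t i ∈ ht.gen.carrier := ⟨{i}, ht.map_singleton i⟩

theorem gen_le {w : BSub A} : ht.gen ≤ w ↔ ∀ i, t i ∈ w.carrier := by
  constructor
  · exact fun h i => h (ht.apply_mem_gen i)
  · rintro h _ ⟨S, rfl⟩
    exact BSub.sum_mem (fun i _ => h i) (ht.sum_eq_map S)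

theorem encard_gen : ht.gen.carrier.encard = 2 ^ Fintype.card ι := by
  have : ht.gen.carrier = ht.map '' Set.univ := Set.image_univ.symm
  rw [this, ht.isEmb.injective.encard_image, Set.encard_univ, ENat.card_eq_coe_fintype_card,
    Fintype.card_finset]
  norm_cast

end IsPartition

theorem isPartition_pair {a : A} (h0 : a ≠ 0) (h1 : a ≠ 1) : IsPartition ![a, aᶜ] where
  sum_eq := by simpa [Fin.sum_univ_succ] using of_add_compl a
  ne_zero i := by
    have : aᶜ ≠ 0 := fun h => h1 (by rw [compl_eq_iff.1 h, compl_zero])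
    fin_cases i
    · exact h0
    · exact this

/-! ### The Boolean subalgebra generated by an element -/

open Classical in
/-- The Boolean subalgebra `{0, 1, a, a'}`. -/
noncomputable def sgl (a : A) : BSub A :=
  -- For `a = 0` or `a = 1` the pair `a, a'` has a zero entry and is not a partition; the value `⊥`
  -- is then the right one.
  if h : a ≠ 0 ∧ a ≠ 1 then (isPartition_pair h.1 h.2).gen else ⊥

theorem self_mem_sgl (a : A) : a ∈ (sgl a).carrier := by
  rw [sgl]
  split_ifs with h
  · exact (isPartition_pair h.1 h.2).apply_mem_gen 0
  · rw [BSub.mem_bot]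
    tauto

theorem sgl_le {a : A} {w : BSub A} : sgl a ≤ w ↔ a ∈ w.carrier := by
  refine ⟨fun h => h (self_mem_sgl a), fun h => ?_⟩
  rw [sgl]
  split_ifs with h'
  · rw [IsPartition.gen_le]
    intro i
    fin_cases i
    · exact h
    · exact BSub.compl_mem h
  · exact bot_le

theorem mem_sgl {a b : A} : b ∈ (sgl a).carrier ↔ b = 0 ∨ b = 1 ∨ b = a ∨ b = aᶜ := by
  constructor
  · rw [sgl]
    split_ifs with h
    · rintro ⟨S, rfl⟩
      have key : ∀ S : Finset (Fin 2), S = ⊥ ∨ S = ⊤ ∨ S = {0} ∨ S = {1} := by decide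
      have ht := isPartition_pair h.1 h.2
      rcases key S with rfl | rfl | rfl | rfl
      · exact Or.inl ht.isEmb.map_bot
      · exact Or.inr (Or.inl ht.isEmb.map_top)
      · exact Or.inr (Or.inr (Or.inl (ht.map_singleton 0)))
      · exact Or.inr (Or.inr (Or.inr (ht.map_singleton 1)))
    · exact fun h => h.elim Or.inl fun h => Or.inr (Or.inl h)
  · rintro (rfl | rfl | rfl | rfl)
    · exact BSub.zero_mem _
    · exact BSub.one_mem _
    · exact self_mem_sgl b
    · exact BSub.compl_mem (self_mem_sgl a)

theorem sgl_compl (a : A) : sgl aᶜ = sgl a := by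
  ext b
  rw [mem_sgl, mem_sgl, compl_compl']
  tauto

theorem sgl_zero : sgl (0 : A) = ⊥ := by
  ext b
  rw [mem_sgl, BSub.mem_bot, compl_zero]
  tauto

theorem sgl_eq_bot_iff {a : A} : sgl a = ⊥ ↔ a = 0 ∨ a = 1 := by
  rw [← le_bot_iff, sgl_le, BSub.mem_bot]

theorem sgl_eq_iff {a b : A} : sgl a = sgl b ↔ a = b ∨ a = bᶜ := by
  constructor
  · intro h
    have h1 : a ∈ (sgl b).carrier := h ▸ self_mem_sgl a
    have h2 : b ∈ (sgl a).carrier := h ▸ self_mem_sgl b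
    rw [mem_sgl] at h1 h2
    rcases h1 with rfl | rfl | h1 | h1
    · rw [compl_zero] at h2
      rcases h2 with rfl | rfl | rfl | rfl <;> simp [compl_one]
    · rw [compl_one] at h2
      rcases h2 with rfl | rfl | rfl | rfl <;> simp [compl_zero]
    · exact Or.inl h1
    · exact Or.inr h1
  · rintro (rfl | rfl)
    · rfl
    · exact sgl_compl b

theorem isAtom_sgl {a : A} (h : sgl a ≠ ⊥) : IsAtom (sgl a) := by
  refine ⟨h, fun y hy => ?_⟩
  ext b
  rw [BSub.mem_bot]
  constructor
  · intro hb
    rcases mem_sgl.1 (hy.le hb) with h | h | rfl | rfl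
    · exact Or.inl h
    · exact Or.inr h
    · exact absurd (sgl_le.2 hb) (not_le_of_gt hy)
    · exact absurd (sgl_le.2 (BSub.compl_mem_iff.1 hb)) (not_le_of_gt hy)
  · rintro (rfl | rfl)
    · exact y.zero_mem
    · exact y.one_mem

theorem isBasic_iff_exists_sgl {x : BSub A} : IsBasic x ↔ ∃ a, x = sgl a := by
  constructor
  · rintro (rfl | h)
    · exact ⟨0, sgl_zero.symm⟩
    · have : ∃ a ∈ x.carrier, ¬ (a = 0 ∨ a = 1) := by
        by_contra! h'
        exact h.1 (le_bot_iff.1 fun a ha => h' a ha)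
      obtain ⟨a, ha, ha'⟩ := this
      have hle := sgl_le.2 ha
      refine ⟨a, ((h.le_iff.1 hle).resolve_left fun h' => ha' (sgl_eq_bot_iff.1 h')).symm⟩
  · rintro ⟨a, rfl⟩
    exact or_iff_not_imp_left.2 isAtom_sgl

/-! ### Principal ideal subalgebras -/

/-- Orthogonal elements: their sum is defined. -/
def Orth (a b : A) : Prop := ∃ c, of a + of b = of c

/-- The order of `B` is visible in the sums of `A`. Principal ideals can therefore be described
without reference to a chosen Boolean algebra. -/
theorem IsEmb.orth_compl_iff {B : Type v} [BooleanAlgebra B] {f : B → A} (hf : IsEmb f) {a b : B} :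
    Orth (f a) (f b)ᶜ ↔ a ≤ b := by
  rw [← hf.map_compl, Orth, hf.exists_add_iff, ← le_compl_iff_disjoint_right, compl_compl]

theorem exists_principal {w : BSub A} {a : A} (ha : a ∈ w.carrier) : ∃ y : BSub A,
    ∀ b, b ∈ y.carrier ↔ b ∈ w.carrier ∧ (Orth b aᶜ ∨ Orth bᶜ aᶜ) := by
  obtain ⟨B, _, f, hf, hw⟩ := w.exists_isEmb
  rw [← hw] at ha ⊢
  obtain ⟨a, rfl⟩ := ha
  refine ⟨hf.map (BoolSub.pr a), fun b => ?_⟩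
  constructor
  · intro h
    obtain ⟨b, hb, rfl⟩ := hf.mem_map.1 h
    rw [← hf.map_compl b, hf.orth_compl_iff, hf.orth_compl_iff]
    exact ⟨⟨b, rfl⟩, hb⟩
  · rintro ⟨⟨b, rfl⟩, h⟩
    rw [← hf.map_compl b, hf.orth_compl_iff, hf.orth_compl_iff] at h
    exact hf.apply_mem_map.2 h

open Classical in
/-- The elements of `w` that are comparable to `a` in the sense that they or their complements lie
below `a`. -/
noncomputable def principal (w : BSub A) (a : A) : BSub A :=
  -- The default value `w` makes `principal_le` hold without a membership hypothesis.
  if h : a ∈ w.carrier then (exists_principal h).choose else w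

theorem mem_principal {w : BSub A} {a : A} (ha : a ∈ w.carrier) {b : A} :
    b ∈ (principal w a).carrier ↔ b ∈ w.carrier ∧ (Orth b aᶜ ∨ Orth bᶜ aᶜ) := by
  rw [principal, dif_pos ha]
  exact (exists_principal ha).choose_spec b

theorem principal_le (w : BSub A) (a : A) : principal w a ≤ w := by
  by_cases ha : a ∈ w.carrier
  · exact fun b hb => ((mem_principal ha).1 hb).1
  · rw [principal, dif_neg ha]

theorem IsEmb.apply_mem_principal {B : Type v} [BooleanAlgebra B] {f : B → A} (hf : IsEmb f)
    {w : BSub A} (hw : Set.range f = w.carrier) {a b : B} :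
    f b ∈ (principal w (f a)).carrier ↔ b ∈ BoolSub.pr a := by
  rw [mem_principal (hw ▸ Set.mem_range_self a), ← hf.map_compl b, hf.orth_compl_iff,
    hf.orth_compl_iff, and_iff_right (hw ▸ Set.mem_range_self b)]
  rfl

theorem IsEmb.apply_mem_sgl {B : Type v} [BooleanAlgebra B] {f : B → A} (hf : IsEmb f) {a b : B} :
    f b ∈ (sgl (f a)).carrier ↔ b ∈ BoolSub.sg a := by
  rw [mem_sgl, ← hf.map_compl, ← hf.map_top, ← hf.map_bot, BoolSub.mem_sg]
  simp only [hf.injective.eq_iff]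

theorem mem_principal_and {w : BSub A} {a : A} (ha : a ∈ w.carrier) {b : A} :
    b ∈ (principal w a).carrier ∧ b ∈ (principal w aᶜ).carrier ↔ b ∈ (sgl a).carrier := by
  obtain ⟨B, _, f, hf, hw⟩ := w.exists_isEmb
  by_cases hb : b ∈ w.carrier
  · rw [← hw] at ha hb
    obtain ⟨a, rfl⟩ := ha
    obtain ⟨b, rfl⟩ := hb
    rw [← hf.map_compl, hf.apply_mem_principal hw, hf.apply_mem_principal hw, hf.apply_mem_sgl,
      ← BoolSub.pr_inf_pr_compl]
    rfl
  · exact iff_of_false (fun h => hb (principal_le _ _ h.1)) fun h => hb (sgl_le.2 ha h)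

theorem principal_compl_eq {w : BSub A} {a : A} (ha : a ∈ w.carrier)
    (h : principal w a = sgl a) : principal w aᶜ = w := by
  refine le_antisymm (principal_le _ _) fun b hb => ?_
  obtain ⟨B, _, f, hf, hw⟩ := w.exists_isEmb
  have ha' := ha
  have hb' : b ∈ w.carrier := hb
  rw [← hw] at ha' hb'
  obtain ⟨a, rfl⟩ := ha'
  obtain ⟨b, rfl⟩ := hb'
  have : BoolSub.pr a = BoolSub.sg a := SetLike.ext fun c => by
    rw [← hf.apply_mem_principal hw, h, hf.apply_mem_sgl]
  change f b ∈ (principal w (f a)ᶜ).carrier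
  rw [← hf.map_compl, hf.apply_mem_principal hw, BoolSub.pr_compl_eq_top this]
  exact BooleanSubalgebra.mem_top

theorem sgl_le_principal {w : BSub A} {a : A} (ha : a ∈ w.carrier) : sgl a ≤ principal w a :=
  fun _ hb => ((mem_principal_and ha).2 hb).1

/-- Two equal ideal subalgebras both coincide with their intersection `sgl a`, and then the one of
`aᶜ` is all of `w`. So strictly above `sgl a` the elements `a` and `aᶜ` are told apart. -/
theorem eq_sgl_of_principal_eq {w : BSub A} {a : A} (ha : a ∈ w.carrier)
    (h : principal w a = principal w aᶜ) : w = sgl a := by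
  have h1 : principal w a = sgl a := by
    ext b
    rw [← mem_principal_and ha, ← h, and_self]
  rw [← h1, h, principal_compl_eq ha h1]

/-- Nothing lies strictly between `sgl a` and `w`, so each ideal subalgebra is one of these two. If
one of them is `sgl a`, the other is `w`. -/
theorem principal_of_covBy {w : BSub A} {a : A}
    (h : ∀ y, sgl a ≤ y → y < w → y = sgl a) (ha : a ∈ w.carrier) :
    (principal w a = sgl a ∧ principal w aᶜ = w) ∨
      (principal w a = w ∧ principal w aᶜ = sgl a) := by
  have key : ∀ b, sgl b = sgl a → principal w b ≠ w → principal w b = sgl b := by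
    intro b hb hne
    have hbw : b ∈ w.carrier := sgl_le.1 (hb.trans_le (sgl_le.2 ha))
    rw [h _ (hb.symm.trans_le (sgl_le_principal hbw)) (lt_of_le_of_ne (principal_le _ _) hne), hb]
  by_cases h1 : principal w a = w
  · right
    refine ⟨h1, ?_⟩
    by_cases h2 : principal w aᶜ = w
    · rw [h2]
      exact eq_sgl_of_principal_eq ha (h1.trans h2.symm)
    · rw [key _ (sgl_compl a) h2, sgl_compl]
  · have := key a rfl h1
    exact Or.inl ⟨this, principal_compl_eq ha this⟩

end Ortho

namespace Ortho

open OrthoStruct OSum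

variable {A : Type u} [OrthoStruct A] [IsOrthoalgebra A]

/-! ### Cardinality and height -/

namespace BSub

omit [IsOrthoalgebra A] in
theorem exists_mem_notMem_of_lt {x y : BSub A} (h : x < y) :
    ∃ a ∈ y.carrier, a ∉ x.carrier := by
  by_contra! h'
  exact h.not_ge h'

/-- A subalgebra is a subgroup under symmetric difference. For `e` outside it, the coset of `e` is
disjoint from it and of the same size. -/
theorem two_mul_encard_le {x y : BSub A} (h : x < y) :
    2 * x.carrier.encard ≤ y.carrier.encard := by
  obtain ⟨B, _, f, hf, hy⟩ := y.exists_isEmb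
  obtain ⟨a, ha, hax⟩ := exists_mem_notMem_of_lt h
  have hxf : x.carrier ⊆ Set.range f := hy ▸ h.le
  rw [← hy] at ha
  obtain ⟨e, rfl⟩ := ha
  let S := hf.comap x hxf
  have hS : x.carrier = f '' S := (Set.image_preimage_eq_of_subset hxf).symm
  have he : e ∉ S := hax
  have hd : Disjoint (S : Set B) ((fun b => symmDiff e b) '' S) := by
    rw [Set.disjoint_left]
    rintro _ hb ⟨b, hb', rfl⟩
    apply he
    have hmem : ∀ c d : B, c ∈ S → d ∈ S → symmDiff c d ∈ S := fun c d hc hd =>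
      BooleanSubalgebra.sup_mem (BooleanSubalgebra.sdiff_mem hc hd)
        (BooleanSubalgebra.sdiff_mem hd hc)
    have := hmem _ _ hb hb'
    rwa [symmDiff_symmDiff_cancel_right] at this
  rw [← hy, hS, hf.injective.encard_image, two_mul]
  nth_rw 2 [← (symmDiff_right_injective e).encard_image (S : Set B)]
  rw [← Set.encard_union_eq hd, ← Set.image_univ, hf.injective.encard_image]
  exact Set.encard_le_encard (Set.subset_univ _)

theorem one_ne_zero_of_lt {x y : BSub A} (h : x < y) : (1 : A) ≠ 0 := by
  intro h0
  obtain ⟨a, -, hax⟩ := exists_mem_notMem_of_lt h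
  exact hax (eq_zero_of_one_eq_zero h0 a ▸ x.zero_mem)

omit [IsOrthoalgebra A] in
theorem two_le_encard (h : (1 : A) ≠ 0) (x : BSub A) : 2 ≤ x.carrier.encard := by
  rw [← Set.encard_pair h]
  exact Set.encard_le_encard (Set.pair_subset x.one_mem x.zero_mem)

/-- A chain of length `n + 1` starts with at least two elements and doubles at each step, so its top
has at least `2 ^ (n + 2)` elements. -/
theorem height_le_of_encard_lt (n : ℕ) (y : BSub A) (h : y.carrier.encard < 2 ^ (n + 2)) :
    Order.height y ≤ n := by
  induction n generalizing y with
  | zero =>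
    rw [Order.height_le_coe_iff]
    intro x hxy
    have h1 := two_mul_encard_le hxy
    have h2 := mul_le_mul_right (two_le_encard (one_ne_zero_of_lt hxy) x) 2
    have h3 := (h2.trans h1).trans_lt h
    exact absurd h3 (by norm_num)
  | succ n ih =>
    rw [Order.height_le_coe_iff]
    intro x hxy
    refine (ih x ?_).trans_lt (by exact_mod_cast n.lt_succ_self)
    have h1 := (two_mul_encard_le hxy).trans_lt h
    rw [pow_succ, mul_comm (2 ^ (n + 2))] at h1
    exact lt_of_mul_lt_mul_left' h1

end BSub

/-! ### Refining partitions -/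

namespace IsPartition

theorem apply_sup_eq_map {ι : Type v} [Fintype ι] [DecidableEq ι] {t : ι → A} (ht : IsPartition t)
    {B : Type*} [BooleanAlgebra B] {f : B → A} (hf : IsEmb f) {τ : ι → B}
    (hτ : ∀ i, f (τ i) = t i) (S : Finset ι) : f (S.sup τ) = ht.map S := by
  induction S using Finset.induction_on with
  | empty => rw [Finset.sup_empty, hf.map_bot, ← ht.isEmb.map_bot, Finset.bot_eq_empty]
  | insert i S hi ih =>
    have h1 := ht.sum_eq_map (insert i S)
    rw [Finset.sum_insert hi, ht.sum_eq_map, ← ih, ← hτ] at h1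
    rw [Finset.sup_insert]
    rw [hf.map_sup _ _ (hf.disjoint h1)] at h1
    exact of_injective h1

theorem cons_update {n : ℕ} {t : Fin n → A} (ht : IsPartition t) {i : Fin n} {b c : A}
    (h : of b + of c = of (t i)) (hb : b ≠ 0) (hc : c ≠ 0) :
    IsPartition (Fin.cons c (Function.update t i b) : Fin (n + 1) → A) where
  sum_eq := by
    have h1 : (fun j => of (Function.update t i b j)) =
        Function.update (fun j => of (t j)) i (of b) := by
      ext j
      by_cases hj : j = i
      · subst hj; simp
      · simp [hj]
    simp only [Fin.sum_univ_succ, Fin.cons_zero, Fin.cons_succ]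
    rw [h1, Finset.sum_update_of_mem (Finset.mem_univ i), ← add_assoc, add_comm (of c), h,
      ← ht.sum_eq, ← Finset.add_sum_erase _ _ (Finset.mem_univ i), Finset.sdiff_singleton_eq_erase]
  ne_zero j := by
    refine Fin.cases ?_ (fun j => ?_) j
    · simpa using hc
    · rw [Fin.cons_succ]
      by_cases hj : j = i
      · subst hj
        simpa using hb
      · simpa [hj] using ht.ne_zero j

theorem gen_lt_gen {n : ℕ} {t : Fin n → A} (ht : IsPartition t) {t' : Fin (n + 1) → A}
    (ht' : IsPartition t') (h : ht.gen ≤ ht'.gen) : ht.gen < ht'.gen := by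
  refine lt_of_le_of_ne h fun h' => ?_
  have h1 := ht.encard_gen
  rw [h', ht'.encard_gen, Fintype.card_fin, Fintype.card_fin] at h1
  have h2 : 2 ^ (n + 1) = 2 ^ n := by exact_mod_cast h1
  have := Nat.pow_right_injective le_rfl h2
  omega

/-- Take `e ∈ z` outside the generated subalgebra. Some block is neither below `e` nor disjoint from
it, since otherwise `e` would be the join of the blocks below it. Cutting that block along `e` gives
the refinement. -/
theorem exists_refinement {n : ℕ} {t : Fin n → A} (ht : IsPartition t) {z : BSub A}
    (h : ht.gen < z) :
    ∃ (t' : Fin (n + 1) → A) (ht' : IsPartition t'), ht.gen < ht'.gen ∧ ht'.gen ≤ z := by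
  obtain ⟨B, _, f, hf, hz⟩ := z.exists_isEmb
  have hτ : ∀ i, ∃ b, f b = t i := fun i => by
    exact hz.ge (h.le (ht.apply_mem_gen i))
  choose τ hτ using hτ
  obtain ⟨a, ha, hat⟩ := BSub.exists_mem_notMem_of_lt h
  rw [← hz] at ha
  obtain ⟨e, rfl⟩ := ha
  have hsplit : ∃ i, ¬ τ i ≤ e ∧ ¬ Disjoint e (τ i) := by
    classical
    by_contra! hcon
    apply hat
    refine ⟨Finset.univ.filter fun i => τ i ≤ e, ?_⟩
    rw [← ht.apply_sup_eq_map hf hτ]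
    congr 1
    have htop : Finset.univ.sup τ = ⊤ := hf.injective (by
      rw [ht.apply_sup_eq_map hf hτ, hf.map_top]
      exact ht.isEmb.map_top)
    apply le_antisymm
    · exact Finset.sup_le fun i hi => by simpa using hi
    · conv_lhs => rw [← inf_top_eq e, ← htop, Finset.sup_inf_distrib_left]
      refine Finset.sup_le fun i _ => ?_
      by_cases hi : τ i ≤ e
      · exact inf_le_right.trans (Finset.le_sup (f := τ) (by simpa using hi))
      · rw [disjoint_iff.1 (hcon i hi)]
        exact bot_le
  obtain ⟨i, h1, h2⟩ := hsplit
  have hadd : of (f (τ i ⊓ e)) + of (f (τ i \ e)) = of (t i) := by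
    rw [hf.map_sup _ _ disjoint_inf_sdiff, sup_inf_sdiff, hτ]
  have hb : f (τ i ⊓ e) ≠ 0 := fun h => h2 (by
    rw [disjoint_iff, inf_comm]
    exact hf.eq_bot _ h)
  have hc : f (τ i \ e) ≠ 0 := fun h => h1 (sdiff_eq_bot_iff.1 (hf.eq_bot _ h))
  have ht' := ht.cons_update hadd hb hc
  have hfz : ∀ b, f b ∈ z.carrier := fun b => hz ▸ Set.mem_range_self b
  refine ⟨_, ht', ht.gen_lt_gen ht' (ht.gen_le.2 fun j => ?_), ht'.gen_le.2 fun j => ?_⟩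
  · have hj := ht'.apply_mem_gen j.succ
    rw [Fin.cons_succ] at hj
    by_cases hij : j = i
    · subst hij
      rw [Function.update_self] at hj
      have h0 := ht'.apply_mem_gen 0
      rw [Fin.cons_zero] at h0
      exact BSub.add_mem hj h0 hadd
    · rwa [Function.update_of_ne hij] at hj
  · refine Fin.cases ?_ (fun j => ?_) j
    · exact hfz _
    · rw [Fin.cons_succ]
      by_cases hij : j = i
      · subst hij
        rw [Function.update_self]
        exact hfz _
      · rw [Function.update_of_ne hij, ← hτ]
        exact hfz _

/-- The partition `{1}` is refined inside `z` until it generates `z` or has `n + 1` blocks. Each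
refinement raises the height, and `z` need not be finite. -/
theorem exists_gen_eq_or_le (h : (1 : A) ≠ 0) (z : BSub A) (n : ℕ) :
    (∃ k ≤ n, ∃ (t : Fin k → A) (ht : IsPartition t), ht.gen = z) ∨
      ∃ (t : Fin (n + 1) → A) (ht : IsPartition t), ht.gen ≤ z ∧ n ≤ Order.height ht.gen := by
  induction n with
  | zero =>
    right
    have ht : IsPartition ![(1 : A)] :=
      ⟨by simp, fun i => by fin_cases i; exact h⟩
    refine ⟨_, ht, ht.gen_le.2 fun i => ?_, by simp⟩
    fin_cases i
    exact z.one_mem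
  | succ n ih =>
    rcases ih with ⟨k, hk, h⟩ | ⟨t, ht, hle, hn⟩
    · exact Or.inl ⟨k, hk.trans n.le_succ, h⟩
    · rcases hle.eq_or_lt with h | h
      · exact Or.inl ⟨n + 1, le_rfl, t, ht, h⟩
      · obtain ⟨t', ht', h1, h2⟩ := ht.exists_refinement h
        refine Or.inr ⟨t', ht', h2, ?_⟩
        rw [Nat.cast_succ]
        exact (add_le_add_left hn 1).trans (Order.height_add_one_le h1)

/-- The upper bound comes from the cardinality `2 ^ (n + 1)`. For the lower bound
`exists_gen_eq_or_le` is applied to the subalgebra itself, whose cardinality rules out a generating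
partition with at most `n` blocks. -/
theorem height_gen {n : ℕ} {t : Fin (n + 1) → A} (ht : IsPartition t) :
    Order.height ht.gen = n := by
  apply le_antisymm
  · apply BSub.height_le_of_encard_lt
    rw [ht.encard_gen, Fintype.card_fin]
    exact_mod_cast Nat.pow_lt_pow_right Nat.one_lt_two (Nat.lt_succ_self _)
  · have h1 : (1 : A) ≠ 0 := fun h => ht.ne_zero 0 (eq_zero_of_one_eq_zero h _)
    rcases exists_gen_eq_or_le h1 ht.gen n with ⟨k, hk, s, hs, h⟩ | ⟨s, hs, hle, hn⟩
    · have h2 := hs.encard_gen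
      rw [h, ht.encard_gen, Fintype.card_fin, Fintype.card_fin] at h2
      have := Nat.pow_right_injective le_rfl (by exact_mod_cast h2 : 2 ^ (n + 1) = 2 ^ k)
      omega
    · exact hn.trans (Order.height_mono hle)

end IsPartition

theorem exists_partition_of_height {z : BSub A} {n : ℕ} (h1 : (1 : A) ≠ 0)
    (h : Order.height z = n) : ∃ (t : Fin (n + 1) → A) (ht : IsPartition t), ht.gen = z := by
  -- With `n + 1` in place of `n`, the second alternative would force height at least `n + 1`, so
  -- `z` is generated by a partition; `height_gen` then fixes the number of blocks.
  rcases IsPartition.exists_gen_eq_or_le h1 z (n + 1) with ⟨k, hk, s, hs, rfl⟩ | ⟨s, hs, hle, hn⟩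
  · cases k with
    | zero =>
      have h2 := hs.encard_gen
      rw [Fintype.card_fin, pow_zero] at h2
      have := BSub.two_le_encard h1 hs.gen
      rw [h2] at this
      exact absurd this (by norm_num)
    | succ k =>
      rw [hs.height_gen] at h
      obtain rfl : k = n := by exact_mod_cast h
      exact ⟨s, hs, rfl⟩
  · have := hn.trans (Order.height_mono hle)
    rw [h] at this
    have : n + 1 ≤ n := by exact_mod_cast this
    omega

theorem one_ne_zero_of_height_ne_zero {z : BSub A} (h : Order.height z ≠ 0) : (1 : A) ≠ 0 := by
  rw [Order.height_ne_zero, isMin_iff_forall_not_lt] at h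
  push Not at h
  obtain ⟨y, hy⟩ := h
  exact BSub.one_ne_zero_of_lt hy

/-- The elements that cover the one generated by a partition are generated by a refinement. -/
theorem IsPartition.exists_of_forall_lt {n : ℕ} {t : Fin n → A} (ht : IsPartition t) {z : BSub A}
    (h : ht.gen < z) (hz : ∀ y, ht.gen < y → ¬ y < z) :
    ∃ (t' : Fin (n + 1) → A) (ht' : IsPartition t'), ht'.gen = z := by
  obtain ⟨t', ht', h1, h2⟩ := ht.exists_refinement h
  exact ⟨t', ht', h2.eq_of_not_lt (hz _ h1)⟩

theorem sgl_eq_gen {a : A} (h0 : a ≠ 0) (h1 : a ≠ 1) : sgl a = (isPartition_pair h0 h1).gen := by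
  rw [sgl, dif_pos ⟨h0, h1⟩]

end Ortho

namespace Ortho

open OrthoStruct OSum

variable {A : Type u} [OrthoStruct A] [IsOrthoalgebra A]

/-! ### Atoms below a Boolean subalgebra -/

theorem point_ext_iff {p q : (hypergraph A).Point} : p = q ↔ p.1 = q.1 := Subtype.ext_iff

theorem exists_eq_sgl (p : (hypergraph A).Point) : ∃ a, p.1 = sgl a :=
  isBasic_iff_exists_sgl.1 (Or.inr p.2)

/-- Each element `a` of `x` lies in `sgl a`, which is `⊥` or an atom below `x`. -/
theorem setOf_atom_le_subset_iff {x y : BSub A} :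
    ({p | p.1 ≤ x} : Set (hypergraph A).Point) ⊆ {p | p.1 ≤ y} ↔ x ≤ y := by
  refine ⟨fun h a ha => ?_, fun h p hp => le_trans hp h⟩
  rw [← sgl_le] at ha
  change a ∈ y.carrier
  rw [← sgl_le]
  by_cases h0 : sgl a = ⊥
  · rw [h0]
    exact bot_le
  · exact @h ⟨sgl a, isAtom_sgl h0⟩ ha

theorem height_eq_one_of_isAtom {x : BSub A} (h : IsAtom x) : Order.height x = 1 := by
  apply le_antisymm
  · refine Order.height_le_coe_iff.2 fun y hy => ?_
    rw [h.2 y hy, Order.height_bot]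
    exact zero_lt_one
  · rw [Order.one_le_iff_ne_zero, Order.height_ne_zero, isMin_iff_eq_bot]
    exact h.1

theorem isAtom_of_height_eq_one {x : BSub A} (h : Order.height x = 1) : IsAtom x := by
  refine ⟨fun h0 => ?_, fun y hy => ?_⟩
  · rw [h0, Order.height_bot] at h
    exact zero_ne_one h
  · have := Order.height_add_one_le hy
    rw [h] at this
    have h0 : Order.height y ≤ 0 := by
      by_contra hc
      rw [not_le, pos_iff_ne_zero, ← Order.one_le_iff_ne_zero] at hc
      exact absurd ((add_le_add_left hc 1).trans this) (by norm_num)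
    exact isMin_iff_eq_bot.1 (Order.height_eq_zero.1 (le_zero_iff.1 h0))

namespace IsPartition

variable {n : ℕ} {t : Fin n → A} (ht : IsPartition t)
include ht

theorem sgl_map_ne_bot {S : Finset (Fin n)} (h0 : S ≠ ⊥) (h1 : S ≠ ⊤) : sgl (ht.map S) ≠ ⊥ := by
  rw [Ne, sgl_eq_bot_iff, ← ht.isEmb.map_bot, ← ht.isEmb.map_top, ht.isEmb.injective.eq_iff,
    ht.isEmb.injective.eq_iff]
  tauto

theorem sgl_map_compl (S : Finset (Fin n)) : sgl (ht.map Sᶜ) = sgl (ht.map S) := by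
  rw [ht.isEmb.map_compl, sgl_compl]

theorem eq_or_eq_compl {S T : Finset (Fin n)}
    (h : sgl (ht.map S) = sgl (ht.map T)) : S = T ∨ S = Tᶜ := by
  rw [sgl_eq_iff, ← ht.isEmb.map_compl, ht.isEmb.injective.eq_iff,
    ht.isEmb.injective.eq_iff] at h
  exact h

/-- Together with `eq_or_eq_compl` this identifies the atoms with nontrivial sets of blocks up to
complement: three for `n = 3` and seven for `n = 4`. -/
theorem exists_of_atom_le {p : (hypergraph A).Point} (hp : p.1 ≤ ht.gen) :
    ∃ S, S ≠ ⊥ ∧ S ≠ ⊤ ∧ p.1 = sgl (ht.map S) := by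
  obtain ⟨a, ha⟩ := exists_eq_sgl p
  rw [ha, sgl_le] at hp
  obtain ⟨S, rfl⟩ := hp
  refine ⟨S, ?_, ?_, ha⟩
  · rintro rfl
    rw [ht.isEmb.map_bot, sgl_zero] at ha
    exact p.2.1 ha
  · rintro rfl
    rw [ht.isEmb.map_top, ← compl_zero, sgl_compl, sgl_zero] at ha
    exact p.2.1 ha

theorem sgl_map_le (S : Finset (Fin n)) : sgl (ht.map S) ≤ ht.gen :=
  sgl_le.2 ⟨S, rfl⟩

end IsPartition

theorem eq_singleton_or_compl : ∀ S : Finset (Fin 3), S ≠ ⊥ → S ≠ ⊤ →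
    ∃ i, S = {i} ∨ S = {i}ᶜ := by
  decide

namespace IsPartition

variable {t : Fin 3 → A} (ht : IsPartition t)
include ht

theorem sgl_apply_ne_bot (i : Fin 3) : sgl (t i) ≠ ⊥ := by
  rw [← ht.map_singleton]
  revert i
  have : ∀ i : Fin 3, ({i} : Finset (Fin 3)) ≠ ⊥ ∧ ({i} : Finset (Fin 3)) ≠ ⊤ := by decide
  exact fun i => ht.sgl_map_ne_bot (this i).1 (this i).2

theorem atom_le_iff {p : (hypergraph A).Point} : p.1 ≤ ht.gen ↔ ∃ i, p.1 = sgl (t i) := by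
  constructor
  · intro hp
    obtain ⟨S, h0, h1, h⟩ := ht.exists_of_atom_le hp
    obtain ⟨i, rfl | rfl⟩ := eq_singleton_or_compl S h0 h1
    · exact ⟨i, by rw [h, ht.map_singleton]⟩
    · exact ⟨i, by rw [h, ht.sgl_map_compl, ht.map_singleton]⟩
  · rintro ⟨i, h⟩
    rw [h, ← ht.map_singleton]
    exact ht.sgl_map_le _

theorem sgl_injective : Function.Injective fun i => sgl (t i) := by
  intro i j h
  have h2 : ∀ i j : Fin 3, ({i} : Finset (Fin 3)) = {j} ∨ ({i} : Finset (Fin 3)) = {j}ᶜ →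
      i = j := by
    decide
  refine h2 i j (ht.eq_or_eq_compl ?_)
  simpa only [ht.map_singleton] using h

theorem ncard_atoms : ({p | p.1 ≤ ht.gen} : Set (hypergraph A).Point).ncard = 3 := by
  let g : Fin 3 → (hypergraph A).Point := fun i =>
    ⟨sgl (t i), isAtom_sgl (ht.sgl_apply_ne_bot i)⟩
  have hg : Function.Injective g := fun i j h => ht.sgl_injective (congrArg Subtype.val h)
  have : ({p | p.1 ≤ ht.gen} : Set (hypergraph A).Point) = g '' Set.univ := by
    rw [Set.image_univ]
    ext p
    refine ht.atom_le_iff.trans (exists_congr fun i => ?_)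
    rw [point_ext_iff, eq_comm]
  rw [this, Set.ncard_image_of_injective _ hg, Set.ncard_univ, Nat.card_fin]

end IsPartition

/-! ### Planes -/

/-- The corners and edges of a plane, as sets of corners. -/
def planePoint : Fin 7 → Finset (Fin 4) :=
  ![{0}, {1}, {2}, {3}, {0, 1}, {0, 2}, {0, 3}]

/-- The point of a plane given by a set of corners. -/
def planeIndex (S : Finset (Fin 4)) : Fin 7 :=
  if S = {0} ∨ S = {0}ᶜ then 0
  else if S = {1} ∨ S = {1}ᶜ then 1
  else if S = {2} ∨ S = {2}ᶜ then 2
  else if S = {3} ∨ S = {3}ᶜ then 3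
  else if S = {0, 1} ∨ S = {0, 1}ᶜ then 4
  else if S = {0, 2} ∨ S = {0, 2}ᶜ then 5
  else 6

theorem planePoint_ne : ∀ k, planePoint k ≠ ⊥ ∧ planePoint k ≠ ⊤ := by decide

theorem planePoint_index : ∀ S : Finset (Fin 4), S ≠ ⊥ → S ≠ ⊤ →
    S = planePoint (planeIndex S) ∨ S = (planePoint (planeIndex S))ᶜ := by
  decide

theorem planePoint_injective : ∀ j k, planePoint j = planePoint k ∨
    planePoint j = (planePoint k)ᶜ → j = k := by
  decide

/-- The lines of a plane, as finite sets. -/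
def planeLineList : List (Finset (Fin 7)) :=
  [{0, 1, 4}, {2, 3, 4}, {0, 2, 5}, {1, 3, 5}, {0, 3, 6}, {1, 2, 6}]

theorem mem_planeLines_iff {m : Set (Fin 7)} :
    m ∈ planeLines ↔ ∃ l ∈ planeLineList, m = (l : Set (Fin 7)) := by
  simp [planeLines, planeLineList]

/-- Here `S`, `T` and the complement of their union form a coarsening of four blocks to three. Such
a coarsening merges two blocks, which accounts for the six lines. -/
theorem planeLine_of_disjoint : ∀ S T : Finset (Fin 4), S ≠ ⊥ → T ≠ ⊥ → S ⊔ T ≠ ⊤ → Disjoint S T →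
    {planeIndex S, planeIndex T, planeIndex (S ⊔ T)ᶜ} ∈ planeLineList := by
  decide +kernel

theorem exists_disjoint_of_mem_planeLineList : ∀ l ∈ planeLineList, ∃ S T : Finset (Fin 4),
    S ≠ ⊥ ∧ T ≠ ⊥ ∧ S ⊔ T ≠ ⊤ ∧ Disjoint S T ∧
      {planeIndex S, planeIndex T, planeIndex (S ⊔ T)ᶜ} = l := by
  decide +kernel

namespace IsPartition

variable {t : Fin 4 → A} (ht : IsPartition t)

/-- The points of a plane. -/
noncomputable def point (k : Fin 7) : (hypergraph A).Point :=
  ⟨sgl (ht.map (planePoint k)), isAtom_sgl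
    (ht.sgl_map_ne_bot (planePoint_ne k).1 (planePoint_ne k).2)⟩

include ht

theorem point_planeIndex {S : Finset (Fin 4)} (h0 : S ≠ ⊥) (h1 : S ≠ ⊤) :
    (ht.point (planeIndex S)).1 = sgl (ht.map S) := by
  change sgl (ht.map (planePoint (planeIndex S))) = _
  rcases planePoint_index S h0 h1 with h | h
  · rw [← h]
  · rw [← ht.sgl_map_compl, ← h]

theorem point_injective : Function.Injective ht.point := fun j k h =>
  planePoint_injective j k (ht.eq_or_eq_compl (congrArg Subtype.val h))

theorem range_point : Set.range ht.point = {p | p.1 ≤ ht.gen} := by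
  ext p
  constructor
  · rintro ⟨k, rfl⟩
    exact ht.sgl_map_le _
  · intro hp
    obtain ⟨S, h0, h1, h⟩ := ht.exists_of_atom_le hp
    exact ⟨planeIndex S, Subtype.ext ((ht.point_planeIndex h0 h1).trans h.symm)⟩

omit ht in
theorem atoms_eq_image {t : Fin 4 → A} (ht : IsPartition t) {s : Fin 3 → A} (hs : IsPartition s)
    {S T : Finset (Fin 4)} (h0 : s 0 = ht.map S) (h1 : s 1 = ht.map T)
    (hS : S ≠ ⊥) (hT : T ≠ ⊥) (hST : S ⊔ T ≠ ⊤) (hd : Disjoint S T) :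
    ({p | p.1 ≤ hs.gen} : Set (hypergraph A).Point) =
      ht.point '' (({planeIndex S, planeIndex T, planeIndex (S ⊔ T)ᶜ} : Finset (Fin 7)) :
        Set (Fin 7)) := by
  have h2 : s 2 = ht.map (S ⊔ T)ᶜ := by
    rw [ht.isEmb.map_compl]
    apply eq_compl_of_add_eq_one
    rw [← ht.isEmb.map_sup _ _ hd, ← h0, ← h1, ← hs.sum_eq, Fin.sum_univ_three]
  have hS' : S ≠ ⊤ := fun h => hST (by rw [h, top_sup_eq])
  have hT' : T ≠ ⊤ := fun h => hST (by rw [h, sup_top_eq])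
  have h3 : (S ⊔ T)ᶜ ≠ ⊥ := fun h => hST (compl_eq_bot.1 h)
  have h4 : (S ⊔ T)ᶜ ≠ ⊤ := fun h => hS (le_bot_iff.1 (le_sup_left.trans (compl_eq_top.1 h).le))
  have key : ∀ p : (hypergraph A).Point, (∃ i, p.1 = sgl (s i)) ↔ p = ht.point (planeIndex S) ∨
      p = ht.point (planeIndex T) ∨ p = ht.point (planeIndex (S ⊔ T)ᶜ) := by
    intro p
    rw [point_ext_iff, point_ext_iff, point_ext_iff, ht.point_planeIndex hS hS',
      ht.point_planeIndex hT hT', ht.point_planeIndex h3 h4, ← h0, ← h1, ← h2,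
      Fin.exists_fin_succ, Fin.exists_fin_two]
    rfl
  ext p
  refine hs.atom_le_iff.trans ((key p).trans ?_)
  rw [Finset.coe_insert, Finset.coe_insert, Finset.coe_singleton, Set.image_insert_eq,
    Set.image_insert_eq, Set.image_singleton]
  rfl

/-- A line is generated by three blocks. If it lies in the plane, these are partial sums of the four
blocks of `t`, so lines in the plane are three-block coarsenings of `t`. The finite check on `Fin 4`
matches them with `planeLines`. -/
theorem mem_lines_iff {l : Set (hypergraph A).Point} (hl : l ⊆ {p | p.1 ≤ ht.gen}) :
    l ∈ (hypergraph A).lines ↔ ∃ m ∈ planeLines, l = ht.point '' m := by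
  have hne : (1 : A) ≠ 0 := fun h => ht.ne_zero 0 (eq_zero_of_one_eq_zero h _)
  constructor
  · rintro ⟨w, hw, rfl⟩
    obtain ⟨s, hs, rfl⟩ := exists_partition_of_height (n := 2) hne hw
    have hl := setOf_atom_le_subset_iff.1 hl
    have hmem : ∀ i, ∃ S, ht.map S = s i := fun i => hl (hs.apply_mem_gen i)
    obtain ⟨S, hS⟩ := hmem 0
    obtain ⟨T, hT⟩ := hmem 1
    have hsum := hs.sum_eq
    rw [Fin.sum_univ_three] at hsum
    obtain ⟨c, -, hc, -, -⟩ := exists_of_add_eq hsum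
    have hd : Disjoint S T := ht.isEmb.disjoint (c := c) (by rw [hS, hT, hc])
    have hbot : ∀ {i S}, ht.map S = s i → S ≠ ⊥ := by
      rintro i S h rfl
      rw [ht.isEmb.map_bot] at h
      exact hs.ne_zero i h.symm
    have hST : S ⊔ T ≠ ⊤ := by
      intro h
      rw [← hS, ← hT, ht.isEmb.map_sup _ _ hd, h, ht.isEmb.map_top, add_comm] at hsum
      exact hs.ne_zero 2 (eq_zero_of_add_one hsum)
    refine ⟨_, mem_planeLines_iff.2 ⟨_, planeLine_of_disjoint S T (hbot hS) (hbot hT) hST hd, rfl⟩,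
      ?_⟩
    exact ht.atoms_eq_image hs hS.symm hT.symm (hbot hS) (hbot hT) hST hd
  · rintro ⟨m, hm, rfl⟩
    obtain ⟨l, hl', rfl⟩ := mem_planeLines_iff.1 hm
    obtain ⟨S, T, hS, hT, hST, hd, rfl⟩ := exists_disjoint_of_mem_planeLineList l hl'
    have hmap : ∀ S, S ≠ ⊥ → ht.map S ≠ 0 := fun S h h' => h (ht.isEmb.eq_bot S h')
    have hs : IsPartition ![ht.map S, ht.map T, ht.map (S ⊔ T)ᶜ] := by
      refine ⟨?_, fun i => ?_⟩
      · rw [Fin.sum_univ_three]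
        change of (ht.map S) + of (ht.map T) + of (ht.map (S ⊔ T)ᶜ) = _
        rw [ht.isEmb.map_sup _ _ hd, ht.isEmb.map_compl, of_add_compl]
      · fin_cases i
        · exact hmap _ hS
        · exact hmap _ hT
        · exact hmap _ fun h => hST (compl_eq_bot.1 h)
    exact ⟨hs.gen, hs.height_gen, (ht.atoms_eq_image hs rfl rfl hS hT hST hd).symm⟩

end IsPartition

theorem isHypergraph_hypergraph : (hypergraph A).IsHypergraph where
  line_card := by
    rintro _ ⟨w, hw, rfl⟩
    have hne : (1 : A) ≠ 0 := one_ne_zero_of_height_ne_zero (z := w) (by rw [hw]; norm_num)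
    obtain ⟨t, ht, rfl⟩ := exists_partition_of_height (n := 2) hne hw
    exact ht.ncard_atoms
  plane_config := by
    rintro _ ⟨w, hw, rfl⟩
    have hne : (1 : A) ≠ 0 := one_ne_zero_of_height_ne_zero (z := w) (by rw [hw]; norm_num)
    obtain ⟨t, ht, rfl⟩ := exists_partition_of_height (n := 3) hne hw
    exact ⟨ht.point, ht.point_injective, ht.range_point, fun l hl => ht.mem_lines_iff hl⟩

/-! ### The poset of faces -/

theorem mem_faces (B : BSubStar A) :
    ({p | p.1 ≤ B.1} : Set (hypergraph A).Point) = ∅ ∨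
      (∃ p, ({p | p.1 ≤ B.1} : Set (hypergraph A).Point) = {p}) ∨
      ({p | p.1 ≤ B.1} : Set (hypergraph A).Point) ∈ (hypergraph A).lines ∨
      ({p | p.1 ≤ B.1} : Set (hypergraph A).Point) ∈ (hypergraph A).planes := by
  obtain ⟨B, hB⟩ := B
  obtain ⟨n, hn⟩ := ENat.ne_top_iff_exists.1 (ne_top_of_le_ne_top (by norm_num) hB)
  have h3 : n ≤ 3 := by
    rw [← hn] at hB
    exact_mod_cast hB
  interval_cases n
  · left
    have : B = ⊥ := isMin_iff_eq_bot.1 (Order.height_eq_zero.1 hn.symm)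
    ext p
    exact iff_of_false (fun h => p.2.1 (le_bot_iff.1 (h.trans this.le))) fun h => h
  · right; left
    have hat := isAtom_of_height_eq_one hn.symm
    refine ⟨⟨B, hat⟩, ?_⟩
    ext p
    exact (hat.le_iff_eq p.2.1).trans (point_ext_iff (q := ⟨B, hat⟩)).symm
  · exact Or.inr (Or.inr (Or.inl ⟨B, hn.symm, rfl⟩))
  · exact Or.inr (Or.inr (Or.inr ⟨B, hn.symm, rfl⟩))

variable (A) in
/-- The Boolean subalgebras of height at most `3` are the faces of the hypergraph. -/
noncomputable def facesIso : BSubStar A ≃o (hypergraph A).Faces :=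
  RelIso.ofSurjective (OrderEmbedding.ofMapLEIff
    (fun B : BSubStar A => (⟨{p | p.1 ≤ B.1}, mem_faces B⟩ : (hypergraph A).Faces))
    fun _ _ => setOf_atom_le_subset_iff) (by
      rintro ⟨s, rfl | ⟨p, rfl⟩ | ⟨w, hw, rfl⟩ | ⟨w, hw, rfl⟩⟩
      · refine ⟨⊥, Subtype.ext ?_⟩
        ext p
        exact iff_of_false (fun h => p.2.1 (le_bot_iff.1 h)) fun h => h
      · refine ⟨⟨p.1, by rw [height_eq_one_of_isAtom p.2]; norm_num⟩, Subtype.ext ?_⟩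
        ext q
        change q.1 ≤ p.1 ↔ _ = _
        rw [point_ext_iff, p.2.le_iff_eq q.2.1]
      · exact ⟨⟨w, by rw [hw]; norm_num⟩, rfl⟩
      · exact ⟨⟨w, hw.le⟩, rfl⟩)

theorem coe_facesIso (B : BSubStar A) :
    (facesIso A B : Set (hypergraph A).Point) = {p | p.1 ≤ B.1} := rfl

/-! ### Isomorphic hypergraphs -/

namespace PointLinePlane

theorem Isomorphic.symm {H K : PointLinePlane.{u}} (h : H.Isomorphic K) : K.Isomorphic H := by
  obtain ⟨f, hl, ht⟩ := h
  refine ⟨f.symm, fun l => ?_, fun t => ?_⟩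
  · rw [hl, f.image_symm_image]
  · rw [ht, f.image_symm_image]

theorem mem_faces_image {H K : PointLinePlane.{u}} (f : H.Point ≃ K.Point)
    (hl : ∀ l, l ∈ H.lines ↔ f '' l ∈ K.lines) (ht : ∀ t, t ∈ H.planes ↔ f '' t ∈ K.planes)
    (s : Set H.Point) :
    (f '' s = ∅ ∨ (∃ p, f '' s = {p}) ∨ f '' s ∈ K.lines ∨ f '' s ∈ K.planes) ↔
      (s = ∅ ∨ (∃ p, s = {p}) ∨ s ∈ H.lines ∨ s ∈ H.planes) := by
  rw [Set.image_eq_empty, ← hl, ← ht, f.surjective.exists]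
  simp only [← Set.image_singleton, f.injective.image_injective.eq_iff]

/-- Isomorphic hypergraphs have isomorphic posets. -/
theorem Isomorphic.nonempty_faces_orderIso {H K : PointLinePlane.{u}} (h : H.Isomorphic K) :
    Nonempty (H.Faces ≃o K.Faces) := by
  obtain ⟨f, hl, ht⟩ := h
  exact ⟨{
    toFun := fun s => ⟨f '' s.1, (mem_faces_image f hl ht s.1).2 s.2⟩
    invFun := fun s => ⟨f.symm '' s.1, (mem_faces_image f hl ht _).1 (by
      rw [f.image_symm_image]
      exact s.2)⟩
    left_inv := fun s => Subtype.ext (f.symm_image_image s.1)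
    right_inv := fun s => Subtype.ext (f.image_symm_image s.1)
    map_rel_iff' := Set.image_subset_image_iff f.injective }⟩

end PointLinePlane

end Ortho

namespace Ortho

open OrthoStruct OSum

variable {A : Type u} [OrthoStruct A] [IsOrthoalgebra A]

/-! ### Principal ideals of the constants and splittings of complements -/

theorem principal_one (w : BSub A) : principal w 1 = w := by
  ext b
  rw [mem_principal w.one_mem, compl_one]
  exact and_iff_left (Or.inl ⟨b, oplus_zero b⟩)

theorem principal_zero (w : BSub A) : principal w 0 = ⊥ := by
  ext b
  have := mem_principal_and (b := b) w.one_mem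
  rw [principal_one, compl_one, ← compl_zero, sgl_compl, sgl_zero] at this
  rw [← this]
  exact ⟨fun h => ⟨principal_le _ _ h, h⟩, fun h => h.2⟩

/-- Any `e` in `w` outside `sgl a` cuts `aᶜ` into `aᶜ ⊓ e` and `aᶜ \ e`. If a piece vanished, `e` or
`eᶜ` would lie below `a`, so `e` would belong to `principal w a = sgl a`. -/
theorem exists_add_eq_compl {w : BSub A} {a : A} (h : sgl a < w) (ha : principal w a = sgl a) :
    ∃ b ∈ w.carrier, ∃ c ∈ w.carrier, b ≠ 0 ∧ c ≠ 0 ∧ of b + of c = of aᶜ := by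
  obtain ⟨B, _, f, hf, hw⟩ := w.exists_isEmb
  obtain ⟨e, he, hea⟩ := BSub.exists_mem_notMem_of_lt h
  have haw := sgl_le.1 h.le
  rw [← hw] at haw he
  obtain ⟨a, rfl⟩ := haw
  obtain ⟨e, rfl⟩ := he
  rw [← ha, hf.apply_mem_principal hw, BoolSub.mem_pr, not_or] at hea
  refine ⟨f (aᶜ ⊓ e), hw.le ⟨_, rfl⟩, f (aᶜ \ e), hw.le ⟨_, rfl⟩, fun h0 => hea.1 ?_,
    fun h0 => hea.2 ?_, ?_⟩
  · have := hf.eq_bot _ h0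
    rw [inf_comm, ← disjoint_iff, ← le_compl_iff_disjoint_right, compl_compl] at this
    exact this
  · have := sdiff_eq_bot_iff.1 (hf.eq_bot _ h0)
    exact compl_le_iff_compl_le.1 this
  · rw [hf.map_sup _ _ disjoint_inf_sdiff, sup_inf_sdiff, hf.map_compl]

theorem isPartition_triple {a b c : A} (ha : a ≠ 0) (hb : b ≠ 0) (hc : c ≠ 0)
    (h : of a + of b + of c = of 1) : IsPartition ![a, b, c] where
  sum_eq := by
    rw [Fin.sum_univ_three]
    exact h
  ne_zero i := by
    fin_cases i
    · exact ha
    · exact hb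
    · exact hc

theorem isPartition_quadruple {a b c d : A} (ha : a ≠ 0) (hb : b ≠ 0) (hc : c ≠ 0) (hd : d ≠ 0)
    (h : of a + of b + of c + of d = of 1) : IsPartition ![a, b, c, d] where
  sum_eq := by
    rw [Fin.sum_univ_four]
    exact h
  ne_zero i := by
    fin_cases i
    · exact ha
    · exact hb
    · exact hc
    · exact hd

omit [IsOrthoalgebra A] in
theorem BSub.covBy_of_height {x y : BSub A} {n : ℕ} (h : x < y) (hx : Order.height x = n)
    (hy : Order.height y = n + 1) : x ⋖ y := by
  refine ⟨h, fun z hz hz' => ?_⟩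
  have h1 := Order.height_add_one_le hz
  have h2 := (add_le_add_left h1 1).trans (Order.height_add_one_le hz')
  rw [hx, hy] at h2
  have h3 : n + 1 + 1 ≤ n + 1 := by exact_mod_cast h2
  omega

/-! ### The poset of Boolean subalgebras of height at most `3` -/

namespace BSubStar

omit [IsOrthoalgebra A] in
-- The subalgebras of height at most `3` form a lower set, so nothing between `x` and `y` is lost.
theorem covBy_iff {x y : BSubStar A} : x ⋖ y ↔ x.1 ⋖ y.1 := by
  constructor
  · exact fun h => ⟨h.1, fun z hz hz' =>
      h.2 (c := ⟨z, (Order.height_mono hz'.le).trans y.2⟩) hz hz'⟩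
  · exact fun h => ⟨h.1, fun z hz hz' => h.2 (c := z.1) hz hz'⟩

theorem eq_bot_iff {x : BSubStar A} : x = ⊥ ↔ x.1 = ⊥ := Subtype.ext_iff

theorem isAtom_iff {x : BSubStar A} : IsAtom x ↔ IsAtom x.1 := by
  rw [← bot_covBy_iff, covBy_iff, ← bot_covBy_iff]
  rfl

theorem isBasic_iff {x : BSubStar A} : IsBasic x ↔ IsBasic x.1 :=
  or_congr eq_bot_iff isAtom_iff

theorem height_sgl_le (a : A) : Order.height (sgl a) ≤ 1 := by
  by_cases h : sgl a = ⊥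
  · rw [h, Order.height_bot]
    exact zero_le_one
  · rw [height_eq_one_of_isAtom (isAtom_sgl h)]

/-- The subalgebra `{0, 1, a, a'}`. -/
noncomputable def sgl (a : A) : BSubStar A :=
  ⟨Ortho.sgl a, (height_sgl_le a).trans (by norm_num)⟩

/-- The principal ideal subalgebra of `a` in `w`. -/
noncomputable def principal (w : BSubStar A) (a : A) : BSubStar A :=
  ⟨Ortho.principal w.1 a, (Order.height_mono (principal_le _ _)).trans w.2⟩

theorem isBasic_iff_exists {x : BSubStar A} : IsBasic x ↔ ∃ a, x = sgl a := by
  rw [isBasic_iff, isBasic_iff_exists_sgl]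
  exact exists_congr fun a => (Subtype.ext_iff (a1 := x) (a2 := sgl a)).symm

theorem isBasic_sgl (a : A) : IsBasic (sgl a) := isBasic_iff_exists.2 ⟨a, rfl⟩

theorem sgl_le {a : A} {w : BSubStar A} : sgl a ≤ w ↔ a ∈ w.1.carrier := Ortho.sgl_le

theorem sgl_compl (a : A) : sgl aᶜ = sgl a := Subtype.ext (Ortho.sgl_compl a)

theorem sgl_eq_iff {a b : A} : sgl a = sgl b ↔ a = b ∨ a = bᶜ :=
  Subtype.ext_iff.trans Ortho.sgl_eq_iff

theorem principal_le (w : BSubStar A) (a : A) : principal w a ≤ w := Ortho.principal_le _ _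

/-- Whether an element belongs to the ideal subalgebra of `a` depends on sums in `A` only, not on
the surrounding subalgebra. This is the restriction axiom of directions. -/
theorem isGLB_principal {y z : BSubStar A} {a : A} (ha : a ∈ y.1.carrier) (h : y ≤ z) :
    IsGLB {y, principal z a} (principal y a) := by
  have hz : a ∈ z.1.carrier := h ha
  constructor
  · rintro _ (rfl | rfl)
    · exact principal_le _ _
    · intro b hb
      have := (mem_principal ha).1 hb
      exact (mem_principal hz).2 ⟨h this.1, this.2⟩
  · intro u hu b hb
    have h1 : b ∈ y.1.carrier := hu (Set.mem_insert _ _) hb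
    have h2 : b ∈ (Ortho.principal z.1 a).carrier :=
      hu (Set.mem_insert_of_mem _ (Set.mem_singleton _)) hb
    exact (mem_principal ha).2 ⟨h1, ((mem_principal hz).1 h2).2⟩

theorem principal_of_covBy {w : BSubStar A} {a : A} (h : sgl a ⋖ w) :
    (principal w a = sgl a ∧ principal w aᶜ = w) ∨
      (principal w a = w ∧ principal w aᶜ = sgl a) := by
  have h1 := covBy_iff.1 h
  have := Ortho.principal_of_covBy (w := w.1) (a := a)
    (fun y hy hyw => (hy.eq_or_lt.resolve_right fun h' => h1.2 h' hyw).symm) (sgl_le.1 h.le)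
  simp only [Subtype.ext_iff]
  exact this

theorem eq_sgl_of_principal_eq {w : BSubStar A} {a : A} (ha : a ∈ w.1.carrier)
    (h : principal w a = principal w aᶜ) : w = sgl a :=
  Subtype.ext (Ortho.eq_sgl_of_principal_eq ha (congrArg Subtype.val h))

/-- The ideal below `w` is the subalgebra lattice of a Boolean algebra by `IsEmb.iicEquiv`, and
`BoolSub.isPrincipalPairFor_iff` is transported along this isomorphism. -/
theorem isPrincipalPairFor_iff {w : BSubStar A} {a : A} (ha : sgl a ≤ w) (y z : Set.Iic w) :
    IsPrincipalPairFor (X := Set.Iic w) ⟨sgl a, ha⟩ y z ↔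
      (y.1 = principal w a ∧ z.1 = principal w aᶜ) ∨
        (y.1 = principal w aᶜ ∧ z.1 = principal w a) := by
  obtain ⟨B, _, f, hf, hw⟩ := w.1.exists_isEmb
  have ha' := sgl_le.1 ha
  rw [← hw] at ha'
  obtain ⟨a, rfl⟩ := ha'
  let e := hf.iicEquiv hw
  have h1 : e ⟨sgl (f a), ha⟩ = BoolSub.sg a := SetLike.ext fun b => hf.apply_mem_sgl
  have h2 : ∀ (a : B) (y : Set.Iic w), y.1 = principal w (f a) ↔ e y = BoolSub.pr a := by
    intro a y
    have : e ⟨principal w (f a), principal_le _ _⟩ = BoolSub.pr a :=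
      SetLike.ext fun b => hf.apply_mem_principal hw
    rw [← this, e.injective.eq_iff]
    exact (Subtype.ext_iff (a1 := y) (a2 := ⟨principal w (f a), principal_le _ _⟩)).symm
  rw [← isPrincipalPairFor_orderIso e, h1, BoolSub.isPrincipalPairFor_iff, ← hf.map_compl,
    h2, h2, h2, h2]

/-- The height as a natural number. -/
noncomputable def rank (x : BSubStar A) : ℕ := (Order.height x.1).toNat

omit [IsOrthoalgebra A] in
theorem coe_rank (x : BSubStar A) : (x.rank : ℕ∞) = Order.height x.1 :=
  ENat.natCast_toNat (ne_top_of_le_ne_top (by norm_num) x.2)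

omit [IsOrthoalgebra A] in
theorem rank_le (x : BSubStar A) : x.rank ≤ 3 := by
  have := x.2
  rw [← coe_rank] at this
  exact_mod_cast this

omit [IsOrthoalgebra A] in
theorem rank_lt_rank {x y : BSubStar A} (h : x < y) : x.rank < y.rank := by
  have : Order.height x.1 + 1 ≤ Order.height y.1 := Order.height_add_one_le h
  rw [← coe_rank, ← coe_rank] at this
  exact_mod_cast this

omit [IsOrthoalgebra A] in
theorem exists_covBy_le {x w : BSubStar A} (h : x < w) : ∃ y, x ⋖ y ∧ y ≤ w := by
  obtain ⟨y, ⟨hy, hyw⟩, hmin⟩ := WellFounded.has_min (InvImage.wf rank Nat.lt_wfRel.wf)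
    {y : BSubStar A | x < y ∧ y ≤ w} ⟨w, h, le_rfl⟩
  exact ⟨y, ⟨hy, fun z hz hz' => hmin z ⟨hz, hz'.le.trans hyw⟩ (rank_lt_rank hz')⟩, hyw⟩

omit [IsOrthoalgebra A] in
-- Ranks are at most `3`; in a directed set an element of largest rank is the greatest. Directed
-- joins and compactness of atoms follow.
theorem exists_isGreatest {S : Set (BSubStar A)} (hS : S.Nonempty) (hd : DirectedOn (· ≤ ·) S) :
    ∃ u, IsGreatest S u := by
  obtain ⟨y, hy, hmin⟩ := WellFounded.has_min
    (InvImage.wf (fun y : BSubStar A => 3 - y.rank) Nat.lt_wfRel.wf) S hS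
  refine ⟨y, hy, fun z hz => ?_⟩
  obtain ⟨u, hu, hyu, hzu⟩ := hd y hy z hz
  rcases hyu.eq_or_lt with h | h
  · exact hzu.trans h.ge
  · refine absurd ?_ (hmin u hu)
    change 3 - u.rank < 3 - y.rank
    have := rank_lt_rank h
    have := rank_le u
    omega

/-- The elements covering an atom are generated by three orthogonal elements. -/
theorem exists_gen_of_covBy {a : A} {w : BSubStar A} (h0 : sgl a ≠ ⊥) (h : sgl a ⋖ w) :
    ∃ (t : Fin 3 → A) (ht : IsPartition t), ht.gen = w.1 := by
  rw [Ne, eq_bot_iff] at h0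
  have h0' := h0
  change Ortho.sgl a ≠ ⊥ at h0'
  rw [Ne, sgl_eq_bot_iff, not_or] at h0'
  have h1 := covBy_iff.1 h
  have h2 : (sgl a).1 = _ := sgl_eq_gen h0'.1 h0'.2
  rw [h2] at h1
  exact (isPartition_pair h0'.1 h0'.2).exists_of_forall_lt h1.lt fun y hy => h1.2 hy

theorem gen_triple_eq {a b c : A} {w : BSubStar A} (ht : IsPartition ![a, b, c]) (h1 : a ≠ 1)
    (h : sgl a ⋖ w) (hb : b ∈ w.1.carrier) (hc : c ∈ w.1.carrier) : ht.gen = w.1 := by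
  have hlt : Ortho.sgl a < ht.gen := by
    have h0 : a ≠ 0 := ht.ne_zero 0
    rw [sgl_eq_gen h0 h1]
    apply IsPartition.gen_lt_gen
    rw [← sgl_eq_gen h0 h1, Ortho.sgl_le]
    exact ht.apply_mem_gen 0
  refine (ht.gen_le.2 fun i => ?_).eq_of_not_lt ((covBy_iff.1 h).2 hlt)
  fin_cases i
  · exact sgl_le.1 h.le
  · exact hb
  · exact hc

/-- Two covers of an atom in which its generators are atoms and coatoms, respectively, have a join
that covers both. -/
theorem exists_join {a : A} {w v : BSubStar A} (hw : sgl a ⋖ w) (hv : sgl a ⋖ v)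
    (hwa : principal w a = sgl a) (hva : principal v aᶜ = sgl a) :
    ∃ u, IsLUB {w, v} u ∧ w ⋖ u ∧ v ⋖ u := by
  have h0 : a ≠ 0 := by
    rintro rfl
    refine hv.lt.ne (hva.symm.trans (Subtype.ext ?_))
    change Ortho.principal v.1 0ᶜ = v.1
    rw [compl_zero, principal_one]
  have h1 : a ≠ 1 := by
    rintro rfl
    refine hw.lt.ne (hwa.symm.trans (Subtype.ext ?_))
    exact principal_one w.1
  have h0' : aᶜ ≠ 0 := fun h => h1 (by rw [compl_eq_iff.1 h, compl_zero])
  have h1' : aᶜ ≠ 1 := fun h => h0 (by rw [compl_eq_iff.1 h, compl_one])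
  -- In `w` the complement of `a` splits as `aᶜ = b + c`. With `aᶜ` in the role of `a`, the same
  -- lemma splits `a = d + e` in `v`, so `b, c, d, e` is a partition of `1` and generates the join.
  obtain ⟨b, hb, c, hc, hb0, hc0, hbc⟩ := exists_add_eq_compl (w := w.1) (a := a) hw.lt
    (congrArg Subtype.val hwa)
  rw [← sgl_compl] at hv hva
  obtain ⟨d, hd, e, he, hd0, he0, hde⟩ := exists_add_eq_compl (w := v.1) (a := aᶜ) hv.lt
    (congrArg Subtype.val hva)
  have hs : IsPartition ![a, b, c] := isPartition_triple h0 hb0 hc0 (by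
    rw [add_assoc, hbc, of_add_compl])
  have hr : IsPartition ![aᶜ, d, e] := isPartition_triple h0' hd0 he0 (by
    rw [add_assoc, hde, of_add_compl])
  have ht : IsPartition ![b, c, d, e] := isPartition_quadruple hb0 hc0 hd0 he0 (by
    rw [add_assoc, hbc, hde, of_add_compl])
  have hsw := gen_triple_eq hs h1 hw hb hc
  have hrv := gen_triple_eq hr h1' hv hd he
  have hb' : b ∈ ht.gen.carrier := ht.apply_mem_gen 0
  have hc' : c ∈ ht.gen.carrier := ht.apply_mem_gen 1
  have hd' : d ∈ ht.gen.carrier := ht.apply_mem_gen 2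
  have he' : e ∈ ht.gen.carrier := ht.apply_mem_gen 3
  have hca' : aᶜ ∈ ht.gen.carrier := BSub.add_mem hb' hc' hbc
  have ha' : a ∈ ht.gen.carrier := BSub.compl_mem_iff.1 hca'
  have hsu : hs.gen ≤ ht.gen := hs.gen_le.2 fun i => by
    fin_cases i
    · exact ha'
    · exact hb'
    · exact hc'
  have hru : hr.gen ≤ ht.gen := hr.gen_le.2 fun i => by
    fin_cases i
    · exact hca'
    · exact hd'
    · exact he'
  refine ⟨⟨ht.gen, ht.height_gen.le⟩, ⟨?_, ?_⟩, ?_, ?_⟩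
  · rintro _ (rfl | rfl)
    · exact hsw.symm.trans_le hsu
    · exact hrv.symm.trans_le hru
  · intro u hu
    have h1 : w ≤ u := hu (Set.mem_insert _ _)
    have h2 : v ≤ u := hu (Set.mem_insert_of_mem _ (Set.mem_singleton _))
    refine ht.gen_le.2 fun i => ?_
    fin_cases i
    · exact h1 hb
    · exact h1 hc
    · exact h2 hd
    · exact h2 he
  · rw [covBy_iff, ← hsw]
    exact BSub.covBy_of_height (hs.gen_lt_gen ht hsu) hs.height_gen ht.height_gen
  · rw [covBy_iff, ← hrv]
    exact BSub.covBy_of_height (hr.gen_lt_gen ht hru) hr.height_gen ht.height_gen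

/-- The cover `w` is generated by three blocks, two of which generate `x` and `y`. The third is the
complement of their sum, so it lies in every subalgebra above both. -/
theorem isLUB_of_atoms {x y w : BSubStar A} (hx : IsAtom x) (hy : IsAtom y) (hxy : x ≠ y)
    (hxw : x ⋖ w) (hyw : y ⋖ w) : IsLUB {x, y} w := by
  constructor
  · rintro _ (rfl | rfl)
    · exact hxw.le
    · exact hyw.le
  · intro u hu
    have h1 : x ≤ u := hu (Set.mem_insert _ _)
    have h2 : y ≤ u := hu (Set.mem_insert_of_mem _ (Set.mem_singleton _))
    obtain ⟨a, rfl⟩ := isBasic_iff_exists.1 (Or.inr hx)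
    obtain ⟨t, ht, htw⟩ := exists_gen_of_covBy hx.1 hxw
    obtain ⟨i, hi⟩ := (ht.atom_le_iff (p := ⟨_, isAtom_iff.1 hx⟩)).1 (htw ▸ hxw.le)
    obtain ⟨j, hj⟩ := (ht.atom_le_iff (p := ⟨_, isAtom_iff.1 hy⟩)).1 (htw ▸ hyw.le)
    have hi' : (sgl a).1 = Ortho.sgl (t i) := hi
    have hj' : y.1 = Ortho.sgl (t j) := hj
    have hij : i ≠ j := by
      rintro rfl
      exact hxy (Subtype.ext (hi.trans hj.symm))
    have hiu : t i ∈ u.1.carrier := Ortho.sgl_le.1 (hi'.symm.trans_le h1)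
    have hju : t j ∈ u.1.carrier := Ortho.sgl_le.1 (hj'.symm.trans_le h2)
    change w.1 ≤ u.1
    rw [← htw, ht.gen_le]
    have key : ∀ i j k : Fin 3, i ≠ j → k = i ∨ k = j ∨
        Disjoint ({i} : Finset (Fin 3)) {j} ∧ (({i} : Finset (Fin 3)) ⊔ {j})ᶜ = {k} := by
      decide
    intro k
    rcases key i j k hij with rfl | rfl | ⟨hd, hk⟩
    · exact hiu
    · exact hju
    · rw [← ht.map_singleton k, ← hk, ht.isEmb.map_compl]
      apply BSub.compl_mem
      refine BSub.add_mem hiu hju ?_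
      rw [← ht.isEmb.map_sup _ _ hd, ht.map_singleton, ht.map_singleton]

theorem isAtomistic : IsAtomistic (BSubStar A) where
  isLUB_atoms w := by
    refine ⟨{x | IsAtom x ∧ x ≤ w}, ⟨fun x hx => hx.2, fun u hu a ha => ?_⟩, fun x hx => hx.1⟩
    rw [← sgl_le] at ha
    change a ∈ u.1.carrier
    rw [← sgl_le]
    rcases isBasic_sgl a with h | h
    · rw [h]
      exact bot_le
    · exact hu ⟨h, ha⟩

theorem isOrthodomain : IsOrthodomain (BSubStar A) where
  directed_join S hS hd := by
    obtain ⟨u, hu⟩ := exists_isGreatest hS hd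
    exact ⟨u, hu.isLUB⟩
  atomistic := isAtomistic
  compact_atom x _ S u hS hd hu hxu := by
    obtain ⟨y, hy⟩ := exists_isGreatest hS hd
    exact ⟨y, hy.1, hxu.trans (hu.unique hy.isLUB).le⟩
  ideal w := by
    obtain ⟨B, hB, f, hf, hw⟩ := w.1.exists_isEmb
    exact ⟨B, hB, ⟨hf.iicEquiv hw⟩⟩
  join_atoms _ _ _ hx hy hxy hxw hyw := isLUB_of_atoms hx hy hxy hxw hyw

/-- Properness gives a larger subalgebra, but perhaps one of height above `3`. An element of it
suffices over `⊥`; over an atom the partition `a, aᶜ` is refined once inside it, giving height `2`.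
-/
theorem exists_sgl_lt (hA : IsProper A) (a : A) : ∃ w, sgl a < w := by
  have hmax : ¬ IsMax (Ortho.sgl a) := by
    intro h
    refine (hA _ h).not_ge ?_
    have : (Ortho.sgl a).carrier = {0, 1, a, aᶜ} := by
      ext b
      exact mem_sgl
    rw [this]
    refine (Set.encard_insert_le _ _).trans ?_
    refine (add_le_add_left (Set.encard_insert_le _ _) 1).trans ?_
    refine (add_le_add_left (add_le_add_left (Set.encard_insert_le _ _) 1) 1).trans ?_
    rw [Set.encard_singleton]
    norm_num
  obtain ⟨y, hy⟩ := not_isMax_iff.1 hmax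
  by_cases h0 : Ortho.sgl a = ⊥
  · obtain ⟨b, -, hb⟩ := BSub.exists_mem_notMem_of_lt hy
    refine ⟨sgl b, ?_⟩
    change Ortho.sgl a < Ortho.sgl b
    rw [h0, bot_lt_iff_ne_bot]
    intro h
    exact hb (h0.trans h.symm ▸ self_mem_sgl b)
  · rw [sgl_eq_bot_iff, not_or] at h0
    have h := sgl_eq_gen h0.1 h0.2
    rw [h] at hy
    obtain ⟨t, ht, h1, -⟩ := (isPartition_pair h0.1 h0.2).exists_refinement hy
    refine ⟨⟨ht.gen, ht.height_gen.trans_le (by norm_num)⟩, ?_⟩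
    change Ortho.sgl a < ht.gen
    rwa [h]

end BSubStar

end Ortho

namespace Ortho

open OrthoStruct OSum

namespace Direction

variable {X : Type u} [PartialOrder X] [OrderBot X]

theorem ext_of_apply {d e : Direction X} (h : d.base = e.base)
    (h' : ∀ w (hd : d.base ≤ w) (he : e.base ≤ w), d.toFun ⟨w, hd⟩ = e.toFun ⟨w, he⟩) : d = e := by
  obtain ⟨x, hx, f, h1, h2, h3⟩ := d
  obtain ⟨y, hy, g, h4, h5, h6⟩ := e
  change x = y at h
  subst h
  have : f = g := funext fun w => h' w.1 w.2 w.2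
  subst this
  rfl

end Direction

/-! ### Directions given by elements -/

namespace BSubStar

variable {A : Type u} [OrthoStruct A] [IsOrthoalgebra A]

/-- The direction given by an element. -/
noncomputable def dir (a : A) : Direction (BSubStar A) where
  base := sgl a
  basic := isBasic_sgl a
  toFun y := (principal y a, principal y aᶜ)
  principal y := by
    refine ⟨principal_le _ _, principal_le _ _, ?_⟩
    exact (isPrincipalPairFor_iff y.2 _ _).2 (Or.inl ⟨rfl, rfl⟩)
  restrict y z h := ⟨isGLB_principal (sgl_le.1 y.2) h,
    isGLB_principal (BSub.compl_mem (sgl_le.1 y.2)) h⟩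
  join y z hy hz h1 h2 := exists_join hy hz (congrArg Prod.fst h1) (congrArg Prod.snd h2)

theorem dir_zero : dir (0 : A) = Direction.zero := by
  refine Direction.ext_of_apply (Subtype.ext sgl_zero) fun w _ _ => ?_
  refine Prod.ext (Subtype.ext (principal_zero w.1)) (Subtype.ext ?_)
  change Ortho.principal w.1 0ᶜ = w.1
  rw [compl_zero, principal_one]

theorem dir_compl (a : A) : dir aᶜ = (dir a).compl := by
  refine Direction.ext_of_apply (sgl_compl a) fun w _ _ => ?_
  change (principal w aᶜ, principal w aᶜᶜ) = (principal w aᶜ, principal w a)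
  rw [compl_compl']

theorem dir_apply_restrict {d : Direction (BSubStar A)} {a : A} (ha : d.base = sgl a)
    {y z : BSubStar A} (hy : d.base ≤ y) (hyz : y ≤ z)
    (h : d.toFun ⟨z, hy.trans hyz⟩ = (principal z a, principal z aᶜ)) :
    d.toFun ⟨y, hy⟩ = (principal y a, principal y aᶜ) := by
  have h1 := d.restrict ⟨y, hy⟩ ⟨z, hy.trans hyz⟩ hyz
  rw [h] at h1
  have hay : a ∈ y.1.carrier := sgl_le.1 (ha ▸ hy)
  exact Prod.ext (h1.1.unique (isGLB_principal hay hyz))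
    (h1.2.unique (isGLB_principal (BSub.compl_mem hay) hyz))

theorem dir_apply (d : Direction (BSubStar A)) {a : A} (ha : d.base = sgl a)
    (y : Set.Ici d.base) :
    d.toFun y = (principal y.1 a, principal y.1 aᶜ) ∨
      d.toFun y = (principal y.1 aᶜ, principal y.1 a) := by
  obtain ⟨h1, h2, h⟩ := d.principal y
  have : (⟨d.base, y.2⟩ : Set.Iic y.1) = ⟨sgl a, ha ▸ y.2⟩ := Subtype.ext ha
  rw [this] at h
  exact ((isPrincipalPairFor_iff (ha ▸ y.2) _ _).1 h).imp
    (fun h => Prod.ext h.1 h.2) fun h => Prod.ext h.1 h.2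

/-- A direction cannot follow an element at one place and its complement at another one. -/
theorem dir_apply_ne {d : Direction (BSubStar A)} {a : A} (ha : d.base = sgl a)
    {w v : BSubStar A} (hw : d.base < w) (hv : d.base < v)
    (h1 : d.toFun ⟨w, hw.le⟩ = (principal w a, principal w aᶜ))
    (h2 : d.toFun ⟨v, hv.le⟩ = (principal v aᶜ, principal v a)) : False := by
  have swap : ∀ {y : BSubStar A}, (principal y aᶜ, principal y a) =
      (principal y aᶜ, principal y aᶜᶜ) := by
    intro y
    rw [compl_compl']
  have ha' : d.base = sgl aᶜ := ha.trans (sgl_compl a).symm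
  obtain ⟨y, hy, hyw⟩ := exists_covBy_le hw
  obtain ⟨z, hz, hzv⟩ := exists_covBy_le hv
  have h3 := dir_apply_restrict ha hy.le hyw h1
  have h4 := (dir_apply_restrict ha' hz.le hzv (h2.trans swap)).trans swap.symm
  have hy' : sgl a ⋖ y := ha ▸ hy
  have hz' : sgl a ⋖ z := ha ▸ hz
  -- At a cover the ideal subalgebras of `a` and `aᶜ` are the base and the whole cover, in some
  -- order. If the orders at `y` and `z` agree, `d` has opposite values there and its join axiom
  -- applies; if they differ, `exists_join` applies.
  have key : ∃ u, y ≤ u ∧ z ≤ u := by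
    have of_join : ∀ {s t u : BSubStar A}, IsLUB {s, t} u → s ≤ u ∧ t ≤ u := fun h =>
      ⟨h.1 (Set.mem_insert _ _), h.1 (Set.mem_insert_of_mem _ (Set.mem_singleton _))⟩
    rcases principal_of_covBy hy' with ⟨hy1, hy2⟩ | ⟨hy1, hy2⟩ <;>
      rcases principal_of_covBy hz' with ⟨hz1, hz2⟩ | ⟨hz1, hz2⟩
    · rw [hy1, hy2, ← ha] at h3
      rw [hz1, hz2, ← ha] at h4
      obtain ⟨u, hu, -⟩ := d.join _ _ hy hz h3 h4
      exact ⟨u, of_join hu⟩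
    · obtain ⟨u, hu, -⟩ := exists_join hy' hz' hy1 hz2
      exact ⟨u, of_join hu⟩
    · obtain ⟨u, hu, -⟩ := exists_join hz' hy' hz1 hy2
      exact ⟨u, (of_join hu).symm⟩
    · rw [hy1, hy2, ← ha] at h3
      rw [hz1, hz2, ← ha] at h4
      obtain ⟨u, hu, -⟩ := d.join _ _ hz hy h4 h3
      exact ⟨u, (of_join hu).symm⟩
  obtain ⟨u, hyu, hzu⟩ := key
  -- At `u` the direction follows `a` or `aᶜ`. Restriction to `z` in the first case and to `y` in
  -- the second contradicts the value there.
  rcases dir_apply d ha ⟨u, hy.le.trans hyu⟩ with h | h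
  · have := dir_apply_restrict ha hz.le hzu h
    rw [h4] at this
    exact hz'.lt.ne' (eq_sgl_of_principal_eq (sgl_le.1 hz'.le) (congrArg Prod.snd this))
  · have := (dir_apply_restrict ha' hy.le hyu (h.trans swap)).trans swap.symm
    rw [h3] at this
    exact hy'.lt.ne' (eq_sgl_of_principal_eq (sgl_le.1 hy'.le) (congrArg Prod.fst this))

theorem principal_sgl (a : A) : principal (sgl a) a = principal (sgl a) aᶜ := by
  have h : ∀ b : A, sgl b = sgl a → principal (sgl a) b = sgl a := fun b hb =>
    le_antisymm (principal_le _ _) (hb ▸ sgl_le_principal (self_mem_sgl b))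
  rw [h a rfl, h _ (sgl_compl a)]

theorem dir_surjective : Function.Surjective (dir : A → Direction (BSubStar A)) := by
  intro d
  obtain ⟨a, ha⟩ := isBasic_iff_exists.1 d.basic
  -- At the base itself the two candidate values coincide, so a place where only one of them is
  -- taken lies strictly above it.
  have lt_of_ne : ∀ y : Set.Ici d.base, ¬ (d.toFun y = (principal y.1 a, principal y.1 aᶜ) ∧
      d.toFun y = (principal y.1 aᶜ, principal y.1 a)) → d.base < y.1 := by
    intro y hy
    refine lt_of_le_of_ne y.2 fun h => hy ?_
    have hs : principal y.1 a = principal y.1 aᶜ := by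
      rw [← h, ha]
      exact principal_sgl a
    have := dir_apply d ha y
    rw [hs, or_self] at this
    rw [hs]
    exact ⟨this, this⟩
  -- If `d` fails to follow `a` at some `v`, it follows `aᶜ` there, and by `dir_apply_ne` it does so
  -- everywhere.
  by_cases h : ∀ y : Set.Ici d.base, d.toFun y = (principal y.1 a, principal y.1 aᶜ)
  · exact ⟨a, Direction.ext_of_apply ha.symm fun w _ hw => (h ⟨w, hw⟩).symm⟩
  · push Not at h
    obtain ⟨v, hv⟩ := h
    refine ⟨aᶜ, Direction.ext_of_apply ((sgl_compl a).trans ha.symm) fun w _ hw => ?_⟩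
    change (principal w aᶜ, principal w aᶜᶜ) = _
    rw [compl_compl']
    by_contra hne
    have hne' : d.toFun ⟨w, hw⟩ ≠ (principal w aᶜ, principal w a) := fun h => hne h.symm
    have h1 := (dir_apply d ha ⟨w, hw⟩).resolve_right hne'
    have h2 := (dir_apply d ha v).resolve_left hv
    exact dir_apply_ne ha (lt_of_ne ⟨w, hw⟩ fun h => hne' h.2) (lt_of_ne v fun h => hv h.1) h1 h2

/-- The base determines the element up to complement. Properness gives a place strictly above the
base, where an element and its complement have different ideal subalgebras. -/
theorem dir_injective (hA : IsProper A) :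
    Function.Injective (dir : A → Direction (BSubStar A)) := by
  intro a b h
  have hb : sgl a = sgl b := congrArg Direction.base h
  rcases sgl_eq_iff.1 hb with h' | rfl
  · exact h'
  · exfalso
    obtain ⟨w, hw⟩ := exists_sgl_lt hA b
    have hw' : (dir b).base ≤ w := hw.le
    have key : ∀ d : Direction (BSubStar A), dir bᶜ = d → ∀ h : d.base ≤ w,
        (d.toFun ⟨w, h⟩).1 = principal w bᶜ := by
      rintro _ rfl _
      rfl
    exact hw.ne' (eq_sgl_of_principal_eq (sgl_le.1 hw.le) (key _ h hw'))

theorem hasEnoughDirections (hA : IsProper A) : HasEnoughDirections (BSubStar A) where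
  orthodomain := isOrthodomain
  proper x hx hb := by
    obtain ⟨a, rfl⟩ := isBasic_iff_exists.1 hb
    obtain ⟨w, hw⟩ := exists_sgl_lt hA a
    exact hx.not_lt hw
  exists_direction x hx := by
    obtain ⟨a, rfl⟩ := isBasic_iff_exists.1 hx
    exact ⟨dir a, rfl⟩

/-! ### Sums of directions -/

theorem _root_.Ortho.IsPartition.principal_apply {t : Fin 3 → A} (ht : IsPartition t) (i : Fin 3) :
    Ortho.principal ht.gen (t i) = Ortho.sgl (t i) := by
  have key : ∀ (i : Fin 3) (S : Finset (Fin 3)), S ≤ {i} ∨ Sᶜ ≤ {i} ↔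
      S = ⊥ ∨ S = ⊤ ∨ S = {i} ∨ S = {i}ᶜ := by
    decide
  rw [← ht.map_singleton i]
  have hmem : Ortho.sgl (ht.map {i}) ≤ ht.gen := Ortho.sgl_le.2 ⟨_, rfl⟩
  ext b
  by_cases hb : b ∈ ht.gen.carrier
  · obtain ⟨S, rfl⟩ := hb
    rw [ht.isEmb.apply_mem_principal rfl, ht.isEmb.apply_mem_sgl, BoolSub.mem_pr, BoolSub.mem_sg]
    exact key i S
  · exact iff_of_false (fun h => hb (Ortho.principal_le _ _ h)) fun h => hb (hmem h)

/-- The atom `sgl a` is generated by some block, so `a` is that block or its complement. In the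
second case both ideal subalgebras would equal `sgl a`, forcing `w = sgl a`. -/
theorem exists_eq_apply {w : BSubStar A} {t : Fin 3 → A} (ht : IsPartition t) (hw : ht.gen = w.1)
    {a : A} (ha : IsAtom (sgl a)) (haw : sgl a < w) (h : principal w a = sgl a) :
    ∃ i, t i = a := by
  have hle : Ortho.sgl a ≤ ht.gen := hw ▸ haw.le
  obtain ⟨i, hi⟩ := (ht.atom_le_iff (p := ⟨_, isAtom_iff.1 ha⟩)).1 hle
  have hi' : Ortho.sgl a = Ortho.sgl (t i) := hi
  rcases Ortho.sgl_eq_iff.1 hi' with h' | h'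
  · exact ⟨i, h'.symm⟩
  · exfalso
    have h1 := ht.principal_apply i
    rw [hw, compl_eq_iff.1 h'.symm] at h1
    refine haw.ne' (eq_sgl_of_principal_eq (sgl_le.1 haw.le) (h.trans (Subtype.ext ?_)))
    exact (h1.trans (Ortho.sgl_compl a)).symm

theorem nearWithJoin_gen {a b c : A} (ht : IsPartition ![a, b, c])
    (hle : Order.height ht.gen ≤ 3) :
    Direction.NearWithJoin (sgl a) (sgl b) ⟨ht.gen, hle⟩ := by
  have hat : ∀ i, IsAtom (Ortho.sgl ((![a, b, c] : Fin 3 → A) i)) := fun i =>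
    isAtom_sgl (ht.sgl_apply_ne_bot i)
  have ha : IsAtom (sgl a) := isAtom_iff.2 (hat 0)
  have hb : IsAtom (sgl b) := isAtom_iff.2 (hat 1)
  have hab : sgl a ≠ sgl b := fun h => by
    have : (0 : Fin 3) = 1 := ht.sgl_injective (congrArg Subtype.val h)
    exact absurd this (by decide)
  have hcov : ∀ i (hi : IsAtom (Ortho.sgl ((![a, b, c] : Fin 3 → A) i))),
      Ortho.sgl ((![a, b, c] : Fin 3 → A) i) ⋖ ht.gen := by
    intro i hi
    have h1 := height_eq_one_of_isAtom hi
    refine BSub.covBy_of_height (lt_of_le_of_ne (Ortho.sgl_le.2 (ht.apply_mem_gen i)) fun h => ?_)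
      h1 ht.height_gen
    rw [h, ht.height_gen] at h1
    exact absurd h1 (by norm_num)
  have h1 : sgl a ⋖ ⟨ht.gen, hle⟩ := covBy_iff.2 (hcov 0 (hat 0))
  have h2 : sgl b ⋖ ⟨ht.gen, hle⟩ := covBy_iff.2 (hcov 1 (hat 1))
  exact ⟨ha, hb, hab, isLUB_of_atoms ha hb hab h1 h2, h1, h2⟩

/-- Apart from the trivial sums, both sides describe a partition `{a, b, cᶜ}`. At the subalgebra `w`
that it generates, the values `(x, w)` say that `a` and `b` are blocks, and the value `(w, z)` says
that `cᶜ` is one. -/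
theorem isSum_dir_iff (hA : IsProper A) {a b c : A} :
    Direction.IsSum (dir a) (dir b) (dir c) ↔ oplus a b = some c := by
  have hinj := dir_injective hA
  have h1 : dir (1 : A) = Direction.zero.compl := by
    rw [← compl_zero, dir_compl, dir_zero]
  rw [← of_add_eq_iff, Direction.IsSum, ← h1, ← dir_zero, ← dir_compl, hinj.eq_iff, hinj.eq_iff,
    hinj.eq_iff, hinj.eq_iff, hinj.eq_iff, hinj.eq_iff]
  constructor
  · rintro (⟨rfl, rfl⟩ | ⟨rfl, rfl⟩ | ⟨rfl, rfl⟩ | ⟨w, hd, he, hf, ⟨ha, hb, hab, -, haw, hbw⟩,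
      ha', hb', hc, hca, hcb, hc'⟩)
    · rw [of_zero, zero_add]
    · rw [of_zero, add_zero]
    · exact of_add_compl a
    · obtain ⟨t, ht, hw⟩ := exists_gen_of_covBy ha.1 haw
      obtain ⟨i, rfl⟩ := exists_eq_apply ht hw ha haw.lt (congrArg Prod.fst ha')
      obtain ⟨j, rfl⟩ := exists_eq_apply ht hw hb hbw.lt (congrArg Prod.fst hb')
      have hc : IsAtom (sgl c) := hc
      have hcw : sgl cᶜ < w := by
        rw [sgl_compl]
        refine lt_of_le_of_ne hf fun h => ha.1 (hc.2 _ ?_)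
        exact haw.lt.trans_eq h.symm
      rw [← sgl_compl] at hc
      obtain ⟨k, hk⟩ := exists_eq_apply ht hw hc hcw
        ((congrArg Prod.snd hc').trans (sgl_compl c).symm)
      have key : ∀ i j k : Fin 3, i ≠ j → k ≠ i → k ≠ j →
          Disjoint ({i} : Finset (Fin 3)) {j} ∧ ({i} : Finset (Fin 3)) ⊔ {j} = {k}ᶜ := by
        decide
      have hne : ∀ l, (dir c).base ≠ (dir (t l)).base → k ≠ l := by
        rintro l hl rfl
        exact hl ((sgl_compl c).symm.trans (congrArg sgl hk.symm))
      obtain ⟨hd, hij⟩ := key i j k (by rintro rfl; exact hab rfl)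
        (hne i hca) (hne j hcb)
      rw [← ht.map_singleton i, ← ht.map_singleton j, ht.isEmb.map_sup _ _ hd, hij,
        ht.isEmb.map_compl, ht.map_singleton, hk, compl_compl']
  · intro h
    by_cases ha : a = 0
    · subst ha
      rw [of_zero, zero_add] at h
      exact Or.inl ⟨rfl, (of_injective h).symm⟩
    by_cases hb : b = 0
    · subst hb
      rw [of_zero, add_zero] at h
      exact Or.inr (Or.inl ⟨rfl, (of_injective h).symm⟩)
    by_cases hc : c = 1
    · subst hc
      exact Or.inr (Or.inr (Or.inl ⟨eq_compl_of_add_eq_one h, rfl⟩))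
    have hc' : cᶜ ≠ 0 := fun h => hc (by rw [compl_eq_iff.1 h, compl_zero])
    have ht : IsPartition ![a, b, cᶜ] := isPartition_triple ha hb hc' (by rw [h, of_add_compl])
    have hle : Order.height ht.gen ≤ 3 := ht.height_gen.trans_le (by norm_num)
    let w : BSubStar A := ⟨ht.gen, hle⟩
    have hpr : ∀ i, principal w ((![a, b, cᶜ] : Fin 3 → A) i) =
        sgl ((![a, b, cᶜ] : Fin 3 → A) i) := fun i => Subtype.ext (ht.principal_apply i)
    have hpr' : ∀ i, principal w ((![a, b, cᶜ] : Fin 3 → A) i)ᶜ = w := fun i =>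
      Subtype.ext (principal_compl_eq (ht.apply_mem_gen i) (ht.principal_apply i))
    have hsgl : ∀ i, sgl ((![a, b, cᶜ] : Fin 3 → A) i) ≤ w := fun i =>
      sgl_le.2 (ht.apply_mem_gen i)
    have hbase : (dir c).base = sgl cᶜ := (sgl_compl c).symm
    have hne : ∀ i, i ≠ 2 → sgl cᶜ ≠ sgl ((![a, b, cᶜ] : Fin 3 → A) i) := fun i hi h =>
      hi (ht.sgl_injective (congrArg Subtype.val h.symm))
    refine Or.inr (Or.inr (Or.inr ⟨w, hsgl 0, hsgl 1, hbase.trans_le (hsgl 2),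
      nearWithJoin_gen ht hle, Prod.ext (hpr 0) (hpr' 0), Prod.ext (hpr 1) (hpr' 1), ?_, ?_, ?_,
      Prod.ext ?_ ((hpr 2).trans hbase.symm)⟩))
    · rw [hbase]
      exact isAtom_iff.2 (isAtom_sgl (ht.sgl_apply_ne_bot 2))
    · rw [hbase]
      exact hne 0 (by decide)
    · rw [hbase]
      exact hne 1 (by decide)
    · have := hpr' 2
      change principal w cᶜᶜ = w at this
      rw [compl_compl'] at this
      exact this

end BSubStar

end Ortho

namespace Ortho

open OrthoStruct OSum

/-! ### Transport along order isomorphisms -/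

section Transport

variable {X Y : Type u} [PartialOrder X] [PartialOrder Y]

/-- An order isomorphism restricts to the principal ideals. -/
def iicCongr (e : X ≃o Y) (x : X) (y : Y) (h : e x = y) : Set.Iic x ≃o Set.Iic y where
  toFun a := ⟨e a, h ▸ e.monotone a.2⟩
  invFun b := ⟨e.symm b, e.symm_apply_le.2 (h ▸ b.2)⟩
  left_inv a := Subtype.ext (e.symm_apply_apply a.1)
  right_inv b := Subtype.ext (e.apply_symm_apply b.1)
  map_rel_iff' := e.le_iff_le

theorem isBooleanDomain_orderIso (e : X ≃o Y) (h : IsBooleanDomain X) : IsBooleanDomain Y := by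
  obtain ⟨B, hB, ⟨f⟩⟩ := h
  exact ⟨B, hB, ⟨e.symm.trans f⟩⟩

variable [OrderBot X] [OrderBot Y]

theorem isOrthodomain_orderIso (e : X ≃o Y) (h : IsOrthodomain X) : IsOrthodomain Y where
  directed_join S hS hd := by
    obtain ⟨u, hu⟩ := h.directed_join (e ⁻¹' S) (hS.preimage e.surjective)
      (fun a ha b hb => by
        obtain ⟨c, hc, hac, hbc⟩ := hd _ ha _ hb
        exact ⟨e.symm c, by simpa using hc, e.le_symm_apply.2 hac, e.le_symm_apply.2 hbc⟩)
    refine ⟨e u, ?_⟩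
    rw [e.isLUB_preimage] at hu
    exact hu
  atomistic := by
    have := h.atomistic
    refine ⟨fun y => ?_⟩
    obtain ⟨s, hs, hs'⟩ := IsAtomistic.isLUB_atoms (e.symm y)
    refine ⟨e '' s, ?_, ?_⟩
    · rw [← e.apply_symm_apply y, e.isLUB_image']
      exact hs
    · rintro _ ⟨x, hx, rfl⟩
      exact (e.isAtom_iff x).2 (hs' x hx)
  compact_atom y hy S u hS hd hu hyu := by
    have hx : IsAtom (e.symm y) := (e.symm.isAtom_iff y).2 hy
    obtain ⟨x, hx, hyx⟩ := h.compact_atom _ hx (e ⁻¹' S) (e.symm u) (hS.preimage e.surjective)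
      (fun a ha b hb => by
        obtain ⟨c, hc, hac, hbc⟩ := hd _ ha _ hb
        exact ⟨e.symm c, by simpa using hc, e.le_symm_apply.2 hac, e.le_symm_apply.2 hbc⟩)
      (by
        rw [e.isLUB_preimage, e.apply_symm_apply]
        exact hu)
      (e.symm.monotone hyu)
    exact ⟨e x, hx, e.symm_apply_le.1 hyx⟩
  ideal y := isBooleanDomain_orderIso (iicCongr e (e.symm y) y (e.apply_symm_apply y)) (h.ideal _)
  join_atoms x y w hx hy hxy hxw hyw := by
    have := h.join_atoms _ _ _ ((e.symm.isAtom_iff x).2 hx) ((e.symm.isAtom_iff y).2 hy)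
      (e.symm.injective.ne hxy) ((apply_covBy_apply_iff e.symm).2 hxw)
      ((apply_covBy_apply_iff e.symm).2 hyw)
    exact (isLUB_pair_orderIso e.symm).1 this

namespace Direction

/-- The image of a direction under an order isomorphism. -/
def map (e : X ≃o Y) (d : Direction X) : Direction Y where
  base := e d.base
  basic := (isBasic_orderIso e).2 d.basic
  toFun y := Prod.map e e (d.toFun ⟨e.symm y, e.le_symm_apply.2 y.2⟩)
  principal y := by
    obtain ⟨h1, h2, h⟩ := d.principal ⟨e.symm y, e.le_symm_apply.2 y.2⟩
    exact ⟨e.le_symm_apply.1 h1, e.le_symm_apply.1 h2, (isPrincipalPairFor_orderIso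
      (iicCongr e (e.symm y) y (e.apply_symm_apply _))).2 h⟩
  restrict y z h := by
    have := d.restrict ⟨e.symm y, e.le_symm_apply.2 y.2⟩ ⟨e.symm z, e.le_symm_apply.2 z.2⟩
      (e.symm.monotone h)
    rw [← isGLB_pair_orderIso e, ← isGLB_pair_orderIso e, e.apply_symm_apply] at this
    exact this
  join y z hy hz h1 h2 := by
    have hcov : ∀ y : Set.Ici (e d.base), e d.base ⋖ (y : Y) → d.base ⋖ e.symm y := fun y hy => by
      rwa [← apply_covBy_apply_iff e, e.apply_symm_apply]
    have hinj : Function.Injective (Prod.map e e) := e.injective.prodMap e.injective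
    obtain ⟨u, hu, h3, h4⟩ := d.join ⟨e.symm y, e.le_symm_apply.2 y.2⟩
      ⟨e.symm z, e.le_symm_apply.2 z.2⟩ (hcov y hy) (hcov z hz)
      (hinj (h1.trans (by simp))) (hinj (h2.trans (by simp)))
    refine ⟨e u, ?_, ?_, ?_⟩
    · rw [← isLUB_pair_orderIso e, e.apply_symm_apply, e.apply_symm_apply] at hu
      exact hu
    · rwa [← apply_covBy_apply_iff e, e.apply_symm_apply] at h3
    · rwa [← apply_covBy_apply_iff e, e.apply_symm_apply] at h4

variable (e : X ≃o Y)

theorem map_apply (d : Direction X) {w : X} (hw : d.base ≤ w) (hw' : (d.map e).base ≤ e w) :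
    (d.map e).toFun ⟨e w, hw'⟩ = Prod.map e e (d.toFun ⟨w, hw⟩) := by
  have : ∀ v (hv : d.base ≤ v), v = w → d.toFun ⟨v, hv⟩ = d.toFun ⟨w, hw⟩ := by
    rintro _ _ rfl
    rfl
  exact congrArg (Prod.map e e) (this _ _ (e.symm_apply_apply w))

theorem map_symm_map (d : Direction X) : (d.map e).map e.symm = d := by
  refine ext_of_apply (e.symm_apply_apply _) fun w h h' => ?_
  have h1 : (d.map e).base ≤ e w := e.monotone h'
  have h2 := map_apply e.symm (d.map e) h1 ((e.symm_apply_apply w).symm ▸ h)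
  rw [map_apply e d h'] at h2
  have : ∀ v (hv : ((d.map e).map e.symm).base ≤ v), v = w →
      ((d.map e).map e.symm).toFun ⟨v, hv⟩ = ((d.map e).map e.symm).toFun ⟨w, h⟩ := by
    rintro _ _ rfl
    rfl
  rw [this _ _ (e.symm_apply_apply w)] at h2
  rw [h2]
  exact Prod.ext (e.symm_apply_apply _) (e.symm_apply_apply _)

theorem map_injective : Function.Injective (map e) :=
  Function.LeftInverse.injective (map_symm_map e)

theorem map_surjective : Function.Surjective (map e) := fun d =>
  ⟨d.map e.symm, map_symm_map e.symm d⟩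

theorem map_zero : (zero : Direction X).map e = zero := by
  refine ext_of_apply e.map_bot fun w h h' => ?_
  exact Prod.ext e.map_bot (e.apply_symm_apply w)

theorem map_compl (d : Direction X) : d.compl.map e = (d.map e).compl := rfl

theorem isSum_map_iff {d₁ d₂ d₃ : Direction X} :
    IsSum (d₁.map e) (d₂.map e) (d₃.map e) ↔ IsSum d₁ d₂ d₃ := by
  have hinj := map_injective e
  have hinj' : Function.Injective (Prod.map e e) := e.injective.prodMap e.injective
  rw [IsSum, IsSum, ← map_zero e, ← map_compl, ← map_compl, hinj.eq_iff, hinj.eq_iff, hinj.eq_iff,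
    hinj.eq_iff, hinj.eq_iff, hinj.eq_iff]
  refine or_congr Iff.rfl (or_congr Iff.rfl (or_congr Iff.rfl ?_))
  have hle : ∀ (d : Direction X) (w : X), (d.map e).base ≤ e w ↔ d.base ≤ w := fun _ _ =>
    e.le_iff_le
  have hnear : ∀ x y w : X, NearWithJoin (e x) (e y) (e w) ↔ NearWithJoin x y w := by
    intro x y w
    rw [NearWithJoin, NearWithJoin, e.isAtom_iff, e.isAtom_iff, e.injective.ne_iff,
      isLUB_pair_orderIso, apply_covBy_apply_iff, apply_covBy_apply_iff]
  have hval : ∀ (d : Direction X) (w a b : X) (h : d.base ≤ w) (h' : (d.map e).base ≤ e w),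
      (d.map e).toFun ⟨e w, h'⟩ = (e a, e b) ↔ d.toFun ⟨w, h⟩ = (a, b) := by
    intro d w a b h h'
    rw [map_apply e d h]
    exact hinj'.eq_iff (b := (a, b))
  rw [e.surjective.exists]
  refine exists_congr fun w => ⟨?_, ?_⟩
  · rintro ⟨h1, h2, h3, hn, hv1, hv2, ha, hne1, hne2, hv3⟩
    exact ⟨(hle _ w).1 h1, (hle _ w).1 h2, (hle _ w).1 h3, (hnear _ _ w).1 hn,
      (hval _ w _ _ _ h1).1 hv1, (hval _ w _ _ _ h2).1 hv2, (e.isAtom_iff _).1 ha,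
      e.injective.ne_iff.1 hne1, e.injective.ne_iff.1 hne2, (hval _ w _ _ _ h3).1 hv3⟩
  · rintro ⟨h1, h2, h3, hn, hv1, hv2, ha, hne1, hne2, hv3⟩
    exact ⟨(hle _ w).2 h1, (hle _ w).2 h2, (hle _ w).2 h3, (hnear _ _ w).2 hn,
      (hval _ w _ _ _ _).2 hv1, (hval _ w _ _ _ _).2 hv2, (e.isAtom_iff _).2 ha,
      e.injective.ne_iff.2 hne1, e.injective.ne_iff.2 hne2, (hval _ w _ _ _ _).2 hv3⟩

end Direction

theorem hasEnoughDirections_orderIso (e : X ≃o Y) (h : HasEnoughDirections X) :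
    HasEnoughDirections Y where
  orthodomain := isOrthodomain_orderIso e h.orthodomain
  proper y hy hb := by
    refine h.proper (e.symm y) (fun x hx => ?_) ((isBasic_orderIso e.symm).2 hb)
    exact e.le_symm_apply.2 (hy (e.symm_apply_le.1 hx))
  exists_direction y hy := by
    obtain ⟨d, hd⟩ := h.exists_direction (e.symm y) ((isBasic_orderIso e.symm).2 hy)
    exact ⟨d.map e, e.symm_apply_eq.1 hd.symm |>.symm⟩

/-- A bijection onto the directions that respects the operations is an isomorphism. -/
theorem isIsomorphism_of_isSum_iff {A : Type u} [OrthoStruct A] [IsOrthoalgebra A]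
    {ξ : A → Direction X} (hξ : Function.Bijective ξ) (h0 : ξ 0 = Direction.zero)
    (hc : ∀ a, ξ aᶜ = (ξ a).compl)
    (hs : ∀ a b c, Direction.IsSum (ξ a) (ξ b) (ξ c) ↔ oplus a b = some c) :
    IsOrthoalgebra (Direction X) ∧ IsIsomorphism ξ := by
  have hone : ξ 1 = 1 := by
    rw [← compl_zero, hc, h0]
    rfl
  have hzero : ξ 0 = 0 := h0
  have hcompl : ∀ a, ξ aᶜ = (ξ a)ᶜ := hc
  -- The sum of directions is defined by choice. By `hs` and surjectivity the chosen direction is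
  -- the image of the sum in `A`, so it is unique.
  have hoplus : ∀ a b c, oplus (ξ a) (ξ b) = some (ξ c) ↔ oplus a b = some c := by
    intro a b c
    rw [← hs]
    by_cases h : ∃ f, Direction.IsSum (ξ a) (ξ b) f
    · have h0 : oplus (ξ a) (ξ b) = some h.choose := dif_pos h
      rw [h0]
      obtain ⟨c', hc'⟩ := hξ.2 h.choose
      have h1 := h.choose_spec
      rw [← hc', hs] at h1
      rw [← hc', hs, h1, Option.some.injEq, Option.some.injEq, hξ.1.eq_iff]
    · have h0 : oplus (ξ a) (ξ b) = none := dif_neg h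
      rw [h0]
      exact iff_of_false (by rintro ⟨⟩) fun h' => h ⟨_, h'⟩
  have hmap : ∀ a b, oplus (ξ a) (ξ b) = (oplus a b).map ξ := by
    intro a b
    ext d
    obtain ⟨c, rfl⟩ := hξ.2 d
    simp [hoplus, hξ.1.eq_iff]
  have hinv : ∀ d, ∃ a, ξ a = d := hξ.2
  refine ⟨⟨fun d e => ?_, fun d e f => ?_, fun d => ?_, fun d e => ?_, fun d => ?_⟩,
    ⟨hcompl, fun a b c => (hoplus a b c).2⟩, ?_⟩
  · obtain ⟨a, rfl⟩ := hinv d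
    obtain ⟨b, rfl⟩ := hinv e
    rw [hmap, hmap, IsOrthoalgebra.comm]
  · obtain ⟨a, rfl⟩ := hinv d
    obtain ⟨b, rfl⟩ := hinv e
    obtain ⟨c, rfl⟩ := hinv f
    have := congrArg (Option.map ξ) (IsOrthoalgebra.assoc a b c)
    simpa only [hmap, Option.bind_map, Option.map_bind, Function.comp_def] using this
  · obtain ⟨a, rfl⟩ := hinv d
    rw [← hcompl, ← hone, hoplus]
    exact IsOrthoalgebra.oplus_compl a
  · obtain ⟨a, rfl⟩ := hinv d
    obtain ⟨b, rfl⟩ := hinv e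
    rw [← hone, hoplus, ← hcompl, hξ.1.eq_iff]
    exact IsOrthoalgebra.compl_unique a b
  · obtain ⟨a, rfl⟩ := hinv d
    rw [← hzero, hξ.1.eq_iff, ← IsOrthoalgebra.oplus_self, hξ.2.exists]
    simp only [hoplus]
  · obtain ⟨g, hgl, hgr⟩ := Function.bijective_iff_has_inverse.1 hξ
    refine ⟨g, ⟨fun d => ?_, fun d e f h => ?_⟩, hgl, hgr⟩
    · apply hξ.1
      rw [hgr, hcompl, hgr]
    · rw [← hoplus, hgr, hgr, hgr]
      exact h

end Transport

/-- A general target `Y` covers both `BSub(A)*` itself, through the identity, and the faces of every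
hypergraph isomorphic to `G(A)`. -/
theorem directions_of_orderIso {A : Type u} [OrthoStruct A] [IsOrthoalgebra A] (hA : IsProper A)
    {Y : Type u} [PartialOrder Y] [OrderBot Y] (e : BSubStar A ≃o Y) :
    HasEnoughDirections Y ∧ IsOrthoalgebra (Direction Y) ∧
      ∃ ξ : A → Direction Y, IsIsomorphism ξ := by
  refine ⟨hasEnoughDirections_orderIso e (BSubStar.hasEnoughDirections hA), ?_⟩
  have hdir : Function.Bijective (BSubStar.dir : A → Direction (BSubStar A)) :=
    ⟨BSubStar.dir_injective hA, BSubStar.dir_surjective⟩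
  have hmap : Function.Bijective (Direction.map e) :=
    ⟨Direction.map_injective e, Direction.map_surjective e⟩
  have := isIsomorphism_of_isSum_iff (ξ := fun a : A => (BSubStar.dir a).map e) (hmap.comp hdir)
    (by rw [BSubStar.dir_zero, Direction.map_zero])
    (fun a => by rw [BSubStar.dir_compl, Direction.map_compl])
    (fun a b c => by rw [Direction.isSum_map_iff, BSubStar.isSum_dir_iff hA])
  exact ⟨this.1, _, this.2⟩

end Ortho

theorem mainTheorem9 {A : Type u} [Ortho.OrthoStruct A] [Ortho.IsOrthoalgebra A] :
    -- `G(A)` is a hypergraph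
    (Ortho.hypergraph A).IsHypergraph ∧
    -- `BSub(A)*` is the poset of the points, lines and planes of `G(A)`
    (∃ e : Ortho.BSubStar A ≃o (Ortho.hypergraph A).Faces,
      ∀ B, (e B : Set (Ortho.hypergraph A).Point) = {p | p.1 ≤ B.1}) ∧
    -- hence it is determined by the isomorphism type of `G(A)`
    (∀ H : Ortho.PointLinePlane.{u}, H.Isomorphic (Ortho.hypergraph A) →
      Nonempty (Ortho.BSubStar A ≃o H.Faces)) ∧
    -- a proper `A` is isomorphic to the orthoalgebra of directions of `BSub(A)*`
    (Ortho.IsProper A →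
      (Ortho.HasEnoughDirections (Ortho.BSubStar A) ∧
        Ortho.IsOrthoalgebra (Ortho.Direction (Ortho.BSubStar A)) ∧
        ∃ ξ : A → Ortho.Direction (Ortho.BSubStar A), Ortho.IsIsomorphism ξ) ∧
      -- and hence to the directions of the poset constructed from its hypergraph
      ∀ H : Ortho.PointLinePlane.{u}, H.Isomorphic (Ortho.hypergraph A) →
        Ortho.HasEnoughDirections H.Faces ∧
        Ortho.IsOrthoalgebra (Ortho.Direction H.Faces) ∧
        ∃ ξ : A → Ortho.Direction H.Faces, Ortho.IsIsomorphism ξ) := by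
  refine ⟨Ortho.isHypergraph_hypergraph, ⟨Ortho.facesIso A, Ortho.coe_facesIso⟩, ?_, fun hA => ?_⟩
  · intro H hH
    obtain ⟨e⟩ := hH.symm.nonempty_faces_orderIso
    exact ⟨(Ortho.facesIso A).trans e⟩
  · refine ⟨Ortho.directions_of_orderIso hA (OrderIso.refl _), fun H hH => ?_⟩
    obtain ⟨e⟩ := hH.symm.nonempty_faces_orderIso
    exact Ortho.directions_of_orderIso hA ((Ortho.facesIso A).trans e)
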